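/- **Setting.** Let $\mathrm{Diff}^\infty([0,\infty))$ be the group of smooth diffeomorphisms of the half line (smooth up to the boundary point $0$, with smooth inverse). Let $p\ge 1$ be an integer, let $\lambda,\mu,\tau\in\mathbb C$ satisfy $|\lambda|\ge|\mu|>1$ and $(\lambda-\mu^p)\tau=0$, and let $\varphi\in \mathrm{Diff}^\infty([0,\infty))$ satisfy $\varphi(x)>x$ for all $x>0$. Put $\tilde R=\mathbb C^2\times[0,\infty)\setminus\{(O,0)\}$ and $$T(z_1,z_2,x)=(\lambda z_1+\tau z_2^p,\ \mu z_2,\ \varphi(x)).$$ The Reeb component given by the Hopf construction is $R=\tilde R/T^{\mathbb Z}$ with the leafwise complex foliation induced by the foliation of $\tilde R$ whose leaves are $\mathbb C^2\times\{x\}$ $(x>0)$ and $(\mathbb C^2\setminus\{O\})\times\{0\}$; its boundary is the primary Hopf surface $H=(\mathbb C^2\setminus\{O\})\times\{0\}/T^{\mathbb Z}$. A leafwise holomorphic smooth automorphism of $R$ is a diffeomorphism of $R$ that preserves the foliation and maps leaves biholomorphically to leaves, and $\mathrm{Aut}(R,H)$ is the group (under composition) of those whose restriction to $H$ is the identity.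 Write $[z_1,z_2,x]\in R$ for the class of $(z_1,z_2,x)\in\tilde R$. Let $Z_\varphi$ be the centralizer of $\varphi$ in $\mathrm{Diff}^\infty([0,\infty))$, and let $\mathcal Z_{\varphi,\lambda}$ be the complex vector space of smooth functions $\beta:(0,\infty)\to\mathbb C$ with $\beta(\varphi(x))=\lambda\beta(x)$ for all $x>0$. The group $Z_\varphi$ acts on $\mathcal Z_{\varphi,\lambda}\times\mathcal Z_{\varphi,\lambda}$ by precomposition; written as a left action, $\eta\cdot(\beta_1,\beta_2)=(\beta_1\circ\eta^{-1},\beta_2\circ\eta^{-1})$. **Theorem 3.9.** Suppose that $\varphi$ is tangent to the identity to infinite order at $0$, that is, all one-sided derivatives of $\varphi(x)-x$ vanish at $x=0$. If $\tau=0$ and $\lambda=\mu$, then $\mathcal Z_{\varphi,\lambda}$ is infinite dimensional and there is a group isomorphism $$(\mathcal Z_{\varphi,\lambda}\times\mathcal Z_{\varphi,\lambda})\rtimes Z_\varphi\ \cong\ \mathrm{Aut}(R,H),$$ under which $((\beta_1,\beta_2),\eta)$ corresponds to the automorphism $$[z_1,z_2,x]\ \longmapsto\ [\,z_1+\beta_1(\eta(x)),\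 z_2+\beta_2(\eta(x)),\ \eta(x)\,],$$ where $\beta_1,\beta_2$ are extended by the value $0$ at $x=0$. (In particular there is a split extension $0\to\mathcal Z_{\varphi,\lambda}\times\mathcal Z_{\varphi,\lambda}\to\mathrm{Aut}(R,H)\to Z_\varphi\to1$, in which the second map assigns to an automorphism its transverse component $\eta$.) -/

import Mathlib

open Set Topology
open scoped NNReal ContDiff Manifold

noncomputable section

namespace LCReeb

/-! ## Diffeomorphisms of the half line -/

/-- A self-map of the half line `[0, ∞)` is smooth, up to and including the boundary point `0`. -/
def SmoothHalfLine (f : ℝ≥0 → ℝ≥0) : Prop :=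
  ContDiffOn ℝ ∞ (fun x : ℝ => (f x.toNNReal : ℝ)) (Ici 0)

theorem SmoothHalfLine.comp {f g : ℝ≥0 → ℝ≥0} (hf : SmoothHalfLine f) (hg : SmoothHalfLine g) :
    SmoothHalfLine (f ∘ g) := by
  have h := ContDiffOn.comp (s := Ici (0 : ℝ)) (t := Ici (0 : ℝ)) hf hg
    (fun x _ => NNReal.coe_nonneg _)
  refine h.congr fun x _ => ?_
  simp [Function.comp]

theorem SmoothHalfLine.id : SmoothHalfLine (fun x => x) :=
  contDiffOn_id.congr fun x hx => by simpa using hx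

/-- `Diff^∞([0, ∞))`, the group (under composition) of smooth diffeomorphisms of the half line. -/
def HalfLineDiffeo : Subgroup (ℝ≥0 ≃ₜ ℝ≥0) where
  carrier := {e | SmoothHalfLine e ∧ SmoothHalfLine e.symm}
  mul_mem' ha hb := ⟨ha.1.comp hb.1, hb.2.comp ha.2⟩
  one_mem' := ⟨SmoothHalfLine.id, SmoothHalfLine.id⟩
  inv_mem' {_} ha := ⟨ha.2, ha.1⟩

theorem homeo_strictMono (e : ℝ≥0 ≃ₜ ℝ≥0) : StrictMono e := by
  refine (e.continuous.strictMono_of_inj e.injective).resolve_right fun h => ?_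
  obtain ⟨b, hb⟩ := e.surjective (e 0 + 1)
  have : e b ≤ e 0 := h.antitone zero_le
  rw [hb] at this
  exact absurd this (by simp)

theorem homeo_map_zero (e : ℝ≥0 ≃ₜ ℝ≥0) : e 0 = 0 := by
  obtain ⟨a, ha⟩ := e.surjective 0
  have h : e 0 ≤ e a := (homeo_strictMono e).monotone zero_le
  rw [ha] at h
  exact le_antisymm h zero_le

theorem homeo_pos (e : ℝ≥0 ≃ₜ ℝ≥0) {x : ℝ≥0} (hx : 0 < x) : 0 < e x := by
  rw [pos_iff_ne_zero] at hx ⊢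
  intro h
  exact hx (e.injective (h.trans (homeo_map_zero e).symm))

/-- `φ` is tangent to the identity to infinite order at `0`: all (one-sided) derivatives
of `φ(x) - x` vanish at `0`. -/
def InfinitelyTangentToId (φ : HalfLineDiffeo) : Prop :=
  ∀ k : ℕ, iteratedDerivWithin k (fun x : ℝ => ((φ.1 x.toNNReal : ℝ≥0) : ℝ) - x) (Ici 0) 0 = 0

/-- `Z_φ`, the centralizer of `φ` in `Diff^∞([0, ∞))`. -/
abbrev Centr (φ : HalfLineDiffeo) : Subgroup HalfLineDiffeo := Subgroup.centralizer {φ}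

/-! ## The functional equation -/

/-- The open half line `(0, ∞)`. -/
abbrev PosLine : Type := Ioi (0 : ℝ≥0)

/-- A homeomorphism of `[0, ∞)` restricted to `(0, ∞)`. -/
def onPos (e : ℝ≥0 ≃ₜ ℝ≥0) (x : PosLine) : PosLine := ⟨e x.1, homeo_pos e x.2⟩

/-- Extension by zero of a function on `(0, ∞)` to `[0, ∞)`. -/
def extendZero (β : PosLine → ℂ) (x : ℝ≥0) : ℂ := if h : 0 < x then β ⟨x, h⟩ else 0

/-- Smoothness of a complex valued function on the open half line `(0, ∞)`
(nothing is required at `0`). -/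
def SmoothPos (β : PosLine → ℂ) : Prop :=
  ContDiffOn ℝ ∞ (fun x : ℝ => extendZero β x.toNNReal) (Ioi 0)

theorem SmoothPos.comp_diffeo {β : PosLine → ℂ} (hβ : SmoothPos β) {e : ℝ≥0 ≃ₜ ℝ≥0}
    (he : SmoothHalfLine e) : SmoothPos (fun x => β (onPos e x)) := by
  have he' : ContDiffOn ℝ ∞ (fun x : ℝ => (e x.toNNReal : ℝ)) (Ioi 0) :=
    ContDiffOn.mono he Ioi_subset_Ici_self
  have h := ContDiffOn.comp (s := Ioi (0 : ℝ)) (t := Ioi (0 : ℝ)) hβ he'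
    (fun x hx => NNReal.coe_pos.2 (homeo_pos e (Real.toNNReal_pos.2 hx)))
  refine h.congr fun x hx => ?_
  have hx' : 0 < x.toNNReal := Real.toNNReal_pos.2 hx
  have := homeo_pos e hx'
  simp [extendZero, hx', this, onPos, Function.comp, -Real.toNNReal_pos]

/-- `𝒵_{φ,λ}`: the complex vector space of smooth functions `β : (0, ∞) → ℂ` with
`β (φ x) = λ β x`. -/
def Sol (φ : HalfLineDiffeo) (lam : ℂ) : Submodule ℂ (PosLine → ℂ) where
  carrier := {β | SmoothPos β ∧ ∀ x, β (onPos φ.1 x) = lam * β x}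
  add_mem' {a b} ha hb := by
    refine ⟨(ContDiffOn.add ha.1 hb.1).congr fun x hx => ?_, fun x => ?_⟩
    · have hx' : 0 < x.toNNReal := Real.toNNReal_pos.2 hx
      simp [extendZero, hx', -Real.toNNReal_pos]
    · simp [ha.2, hb.2, mul_add]
  zero_mem' := by
    refine ⟨contDiffOn_const (c := (0 : ℂ)) |>.congr fun x _ => ?_, fun x => by simp⟩
    simp [extendZero]
  smul_mem' c a ha := by
    refine ⟨(ContDiffOn.mul (contDiffOn_const (c := c)) ha.1).congr fun x hx => ?_, fun x => ?_⟩
    · have hx' : 0 < x.toNNReal := Real.toNNReal_pos.2 hx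
      simp [extendZero, hx', -Real.toNNReal_pos]
    · simp [ha.2]; ring

theorem onPos_comm {φ : HalfLineDiffeo} (η : Centr φ) (x : PosLine) :
    onPos η.1.1 (onPos φ.1 x) = onPos φ.1 (onPos η.1.1 x) := by
  have h : φ * η.1 = η.1 * φ := Subgroup.mem_centralizer_iff.1 η.2 φ rfl
  have h' := congrArg (fun f : HalfLineDiffeo => f.1 x.1) h
  exact Subtype.ext h'.symm

/-- Precomposition of a solution with an element of the centralizer. -/
def precomp {φ : HalfLineDiffeo} {lam : ℂ} (η : Centr φ) (β : Sol φ lam) : Sol φ lam :=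
  ⟨fun x => β.1 (onPos η.1.1 x), β.2.1.comp_diffeo η.1.2.1, fun x => by
    simp only [onPos_comm, β.2.2]⟩

/-- Precomposition is a right action; as usual it is written as the left action
`η • (β₁, β₂) = (β₁ ∘ η⁻¹, β₂ ∘ η⁻¹)` of `Z_φ` by automorphisms of the additive group
`𝒵_{φ,λ} × 𝒵_{φ,λ}`. -/
def precompAction (φ : HalfLineDiffeo) (lam : ℂ) :
    Centr φ →* MulAut (Multiplicative (Sol φ lam × Sol φ lam)) where
  toFun η :=
    { toFun := fun β => .ofAdd (precomp η⁻¹ β.toAdd.1, precomp η⁻¹ β.toAdd.2)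
      invFun := fun β => .ofAdd (precomp η β.toAdd.1, precomp η β.toAdd.2)
      left_inv := fun β => by
        have h : ∀ γ : Sol φ lam, precomp η (precomp η⁻¹ γ) = γ := fun γ =>
          Subtype.ext <| funext fun x => congrArg γ.1 <| Subtype.ext <|
            η.1.1.symm_apply_apply x.1
        simp [h]
      right_inv := fun β => by
        have h : ∀ γ : Sol φ lam, precomp η⁻¹ (precomp η γ) = γ := fun γ =>
          Subtype.ext <| funext fun x => congrArg γ.1 <| Subtype.ext <|
            η.1.1.apply_symm_apply x.1
        simp [h]
      map_mul' := fun _ _ => rfl }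
  map_one' := rfl
  map_mul' η ζ := by
    have h : ∀ γ : Sol φ lam, precomp (η * ζ)⁻¹ γ = precomp η⁻¹ (precomp ζ⁻¹ γ) := fun γ => by
      rw [mul_inv_rev]; rfl
    refine MulEquiv.ext fun β => ?_
    exact congrArg Multiplicative.ofAdd (Prod.ext (h β.toAdd.1) (h β.toAdd.2))

/-! ## Leafwise complex structures

The local model is the half space `ℂ² × [0, ∞)` with leaves `ℂ² × {x}`. -/

/-- `ℂ² × [0, ∞)`. -/
abbrev Model : Type := (ℂ × ℂ) × ℝ≥0

/-- The inclusion of `ℂ² × [0, ∞)` in `ℂ² × ℝ`. -/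
def Model.toReal (p : Model) : (ℂ × ℂ) × ℝ := (p.1, (p.2 : ℝ))

/-- The retraction of `ℂ² × ℝ` to `ℂ² × [0, ∞)`, used to write functions on the half space as
functions on the vector space. -/
def Model.ofReal (p : (ℂ × ℂ) × ℝ) : Model := (p.1, p.2.toNNReal)

@[simp] theorem Model.ofReal_toReal (p : Model) : Model.ofReal (Model.toReal p) = p := by
  simp [Model.ofReal, Model.toReal]

theorem Model.continuous_ofReal : Continuous Model.ofReal := by
  unfold Model.ofReal; fun_prop

/-- A map `f(z, x) = (w, y)` between open subsets of `ℂ² × [0, ∞)` is smooth and leafwise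
holomorphic at `p`: it is smooth up to the boundary, and in a neighbourhood of `p` the transverse
coordinate `y` depends only on `x`, and `w` is holomorphic in `z` when `x` is fixed. -/
def LeafwiseHolomorphicAt (f : Model → Model) (p : Model) : Prop :=
  ContDiffWithinAt ℝ ∞ (Model.toReal ∘ f ∘ Model.ofReal) (range Model.toReal) (Model.toReal p) ∧
  ∃ u : Set Model, IsOpen u ∧ p ∈ u ∧ (∃ g : ℝ≥0 → ℝ≥0, ∀ q ∈ u, (f q).2 = g q.2) ∧
    ∀ x : ℝ≥0, DifferentiableOn ℂ (fun z : ℂ × ℂ => (f (z, x)).1) {z | (z, x) ∈ u}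

theorem LeafwiseHolomorphicAt.congr {f g : Model → Model} {p : Model} {s : Set Model}
    (hf : LeafwiseHolomorphicAt f p) (hs : IsOpen s) (hp : p ∈ s) (h : ∀ q ∈ s, g q = f q) :
    LeafwiseHolomorphicAt g p := by
  obtain ⟨h1, u, hu, hpu, ⟨k, hk⟩, hd⟩ := hf
  refine ⟨h1.congr_of_eventuallyEq ?_ (by simp [h p hp]), u ∩ s, hu.inter hs, ⟨hpu, hp⟩,
    ⟨k, fun q hq => by rw [h q hq.2, hk q hq.1]⟩, fun x => ?_⟩
  · refine Filter.Eventually.filter_mono nhdsWithin_le_nhds ?_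
    have : Model.ofReal ⁻¹' s ∈ 𝓝 (Model.toReal p) :=
      (hs.preimage Model.continuous_ofReal).mem_nhds (by simpa using hp)
    filter_upwards [this] with q hq
    simp [h _ hq]
  · exact ((hd x).mono fun z hz => hz.1).congr fun z hz => by rw [h _ hz.2]

theorem LeafwiseHolomorphicAt.comp {f g : Model → Model} {p : Model}
    (hg : LeafwiseHolomorphicAt g (f p)) (hf : LeafwiseHolomorphicAt f p)
    {s : Set Model} (hs : IsOpen s) (hp : p ∈ s) (hfc : ContinuousOn f s) :
    LeafwiseHolomorphicAt (g ∘ f) p := by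
  obtain ⟨h1, u, hu, hpu, ⟨k, hk⟩, hd⟩ := hf
  obtain ⟨h1', u', hu', hpu', ⟨k', hk'⟩, hd'⟩ := hg
  refine ⟨?_, u ∩ (s ∩ f ⁻¹' u'), hu.inter (hfc.isOpen_inter_preimage hs hu'),
    ⟨hpu, hp, hpu'⟩, ⟨k' ∘ k, fun q hq => ?_⟩, fun x => ?_⟩
  · have := ContDiffWithinAt.comp (x := Model.toReal p) (t := range Model.toReal)
      (g := Model.toReal ∘ g ∘ Model.ofReal) (by simpa using h1') h1
      (fun q _ => ⟨f (Model.ofReal q), rfl⟩)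
    refine this.congr (fun q _ => by simp) (by simp)
  · simp [hk' _ hq.2.2, hk _ hq.1]
  · intro z hz
    have e : ∀ z' : ℂ × ℂ, (z', x) ∈ u → f (z', x) = ((f (z', x)).1, k x) := fun z' hz' =>
      Prod.ext rfl (hk _ hz')
    have hmap : MapsTo (fun z' : ℂ × ℂ => (f (z', x)).1)
        {z' | (z', x) ∈ u ∩ (s ∩ f ⁻¹' u')} {w | (w, k x) ∈ u'} := by
      intro z' hz'
      have := hz'.2.2
      rw [mem_preimage, e z' hz'.1] at this
      exact this
    have := (hd' (k x)).comp ((hd x).mono fun z' hz' => hz'.1) hmap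
    refine (this.congr fun z' hz' => ?_) z hz
    change (g (f (z', x))).1 = (g ((f (z', x)).1, k x)).1
    rw [← e z' hz'.1]

theorem LeafwiseHolomorphicAt.id (p : Model) : LeafwiseHolomorphicAt id p := by
  refine ⟨?_, univ, isOpen_univ, mem_univ _, ⟨fun x => x, fun _ _ => rfl⟩, fun x => ?_⟩
  · refine contDiffWithinAt_id.congr (fun q hq => ?_) (by simp)
    obtain ⟨r, rfl⟩ := hq
    simp
  · exact differentiableOn_id

/-- Membership in the groupoid is required of a map and of its inverse, both continuous. -/
def leafwisePregroupoid : Pregroupoid Model where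
  property f s := ContinuousOn f s ∧ ∀ p ∈ s, LeafwiseHolomorphicAt f p
  comp {f g u v} hf hg hu hv _ :=
    ⟨hg.1.comp (hf.1.mono inter_subset_left) fun _ h => h.2, fun p hp =>
      (hg.2 _ hp.2).comp (hf.2 p hp.1) hu hp.1 hf.1⟩
  id_mem := ⟨continuousOn_id, fun p _ => LeafwiseHolomorphicAt.id p⟩
  locality {f u} hu h := by
    refine ⟨fun p hp => ?_, fun p hp => ?_⟩
    · obtain ⟨v, hv, hpv, hc, _⟩ := h p hp
      exact ((hc p ⟨hp, hpv⟩).continuousAt ((hu.inter hv).mem_nhds ⟨hp, hpv⟩)).continuousWithinAt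
    · obtain ⟨v, hv, hpv, _, hc⟩ := h p hp
      exact hc p ⟨hp, hpv⟩
  congr {f g u} hu h hf := ⟨hf.1.congr h, fun p hp => (hf.2 p hp).congr hu hp h⟩

/-- The groupoid of coordinate changes of a leafwise complex foliation of codimension one with
leaves of complex dimension two: local diffeomorphisms of `ℂ² × [0, ∞)` that are smooth and
leafwise holomorphic, with inverses of the same kind. A 5-manifold with boundary with an atlas
compatible with this groupoid is a manifold with a leafwise complex foliation. -/
def leafwiseGroupoid : StructureGroupoid Model := leafwisePregroupoid.groupoid

/-- The group (under composition) of leafwise holomorphic smooth automorphisms of a manifold with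
a leafwise complex foliation: the homeomorphisms that, together with their inverses, are smooth and
leafwise holomorphic in all foliated charts; they map leaves to leaves, biholomorphically. -/
def LeafwiseAut (M : Type*) [TopologicalSpace M] [ChartedSpace Model M]
    [HasGroupoid M leafwiseGroupoid] : Subgroup (M ≃ₜ M) where
  carrier := {f | ∃ Φ : Structomorph leafwiseGroupoid M M, Φ.toHomeomorph = f}
  mul_mem' := by
    rintro _ _ ⟨Φ, rfl⟩ ⟨Ψ, rfl⟩
    exact ⟨Ψ.trans Φ, rfl⟩
  one_mem' := ⟨Structomorph.refl M, rfl⟩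
  inv_mem' := by
    rintro _ ⟨Φ, rfl⟩
    exact ⟨Φ.symm, rfl⟩

/-! ## The Hopf construction -/

/-- The data of the Hopf construction: the normal form `G(z₁, z₂) = (λ z₁ + τ z₂^p, μ z₂)` of a
primary Hopf surface and an expanding diffeomorphism `φ` of the half line. -/
structure HopfData where
  p : ℕ
  lam : ℂ
  mu : ℂ
  tau : ℂ
  φ : HalfLineDiffeo
  p_pos : 0 < p
  norm_mu_le : ‖mu‖ ≤ ‖lam‖
  one_lt_norm_mu : 1 < ‖mu‖
  resonance : (lam - mu ^ p) * tau = 0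
  expanding : ∀ x : ℝ≥0, 0 < x → x < φ.1 x

namespace HopfData

variable (D : HopfData)

theorem mu_ne_zero : D.mu ≠ 0 := by
  have := D.one_lt_norm_mu
  intro h; rw [h, norm_zero] at this; linarith

theorem lam_ne_zero : D.lam ≠ 0 := by
  have := D.one_lt_norm_mu.trans_le D.norm_mu_le
  intro h; rw [h, norm_zero] at this; linarith

/-- `G(z₁, z₂) = (λ z₁ + τ z₂^p, μ z₂)`. -/
def G : (ℂ × ℂ) ≃ₜ (ℂ × ℂ) where
  toFun z := (D.lam * z.1 + D.tau * z.2 ^ D.p, D.mu * z.2)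
  invFun w := (D.lam⁻¹ * (w.1 - D.tau * (D.mu⁻¹ * w.2) ^ D.p), D.mu⁻¹ * w.2)
  left_inv z := by
    have h1 := D.mu_ne_zero
    have h2 := D.lam_ne_zero
    ext <;> simp [h1, h2]
  right_inv w := by
    have h1 := D.mu_ne_zero
    have h2 := D.lam_ne_zero
    ext <;> simp [h1, h2]
  continuous_toFun := by fun_prop
  continuous_invFun := by fun_prop

/-- `T = G × φ`, on all of `ℂ² × [0, ∞)`; it fixes the point `(O, 0)`. -/
def T : Model ≃ₜ Model := D.G.prodCongr D.φ.1

/-- `R̃ = ℂ² × [0, ∞) ∖ {(O, 0)}`. -/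
abbrev Cover (_D : HopfData) : Type := {q : Model // q ≠ 0}

/-- Two points of `R̃` are identified if they are in the same orbit of `T`. -/
def orbitSetoid : Setoid D.Cover where
  r q r := ∃ n : ℤ, (D.T ^ n) q.1 = r.1
  iseqv :=
    { refl := fun _ => ⟨0, rfl⟩
      symm := by
        rintro q r ⟨n, hn⟩
        refine ⟨-n, ?_⟩
        rw [← hn, ← Homeomorph.mul_apply, ← zpow_add, neg_add_cancel, zpow_zero]
        rfl
      trans := by
        rintro q r s ⟨n, hn⟩ ⟨m, hm⟩
        refine ⟨m + n, ?_⟩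
        rw [zpow_add, Homeomorph.mul_apply, hn, hm] }

/-- The Reeb component `R = R̃ / T^ℤ`, with the quotient topology. -/
def Reeb : Type := Quotient D.orbitSetoid

instance : TopologicalSpace D.Reeb := inferInstanceAs (TopologicalSpace (Quotient D.orbitSetoid))

/-- The projection `R̃ → R`. -/
def proj (q : D.Cover) : D.Reeb := Quotient.mk D.orbitSetoid q

theorem proj_eq_iff {q r : D.Cover} : D.proj q = D.proj r ↔ ∃ n : ℤ, (D.T ^ n) q.1 = r.1 :=
  Quotient.eq (r := D.orbitSetoid)

theorem T_zero : D.T 0 = 0 := by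
  refine Prod.ext (Prod.ext ?_ ?_) (homeo_map_zero _)
  · simp [T, G, D.p_pos.ne']
  · simp [T, G]

theorem T_zpow_zero (n : ℤ) : (D.T ^ n) 0 = 0 := by
  have hinv : D.T⁻¹ 0 = 0 := by
    change D.T.symm 0 = 0
    rw [Homeomorph.symm_apply_eq, D.T_zero]
  induction n with
  | zero => rfl
  | succ n ih => rw [zpow_add_one, Homeomorph.mul_apply, D.T_zero, ih]
  | pred n ih => rw [zpow_sub_one, Homeomorph.mul_apply, hinv, ih]

theorem T_zpow_ne_zero (n : ℤ) {q : Model} (hq : q ≠ 0) : (D.T ^ n) q ≠ 0 := fun h =>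
  hq ((D.T ^ n).injective (h.trans (D.T_zpow_zero n).symm))

theorem continuous_proj : Continuous D.proj := continuous_quotient_mk'

theorem isOpen_ne_zero : IsOpen {q : Model | q ≠ 0} := isOpen_ne

theorem isOpenMap_proj : IsOpenMap D.proj := by
  intro U hU
  have hU' : IsOpen (Subtype.val '' U : Set Model) := isOpen_ne_zero.isOpenMap_subtype_val U hU
  have : D.proj ⁻¹' (D.proj '' U) = ⋃ n : ℤ, Subtype.val ⁻¹' ((D.T ^ n) ⁻¹' (Subtype.val '' U)) := by
    ext q
    simp only [mem_preimage, mem_image, mem_iUnion]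
    constructor
    · rintro ⟨r, hr, h⟩
      obtain ⟨n, hn⟩ := D.proj_eq_iff.1 h.symm
      exact ⟨n, r, hr, hn.symm⟩
    · rintro ⟨n, r, hr, h⟩
      exact ⟨r, hr, (D.proj_eq_iff.2 ⟨n, h.symm⟩).symm⟩
  refine isOpen_coinduced.2 ?_
  change IsOpen (D.proj ⁻¹' (D.proj '' U))
  rw [this]
  exact isOpen_iUnion fun n => (hU'.preimage (D.T ^ n).continuous).preimage continuous_subtype_val

theorem T_pow_succ (n : ℕ) (q : Model) : (D.T ^ (n + 1)) q = D.T ((D.T ^ n) q) := by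
  rw [pow_succ', Homeomorph.mul_apply]

theorem T_pow_snd_mono (n : ℕ) (q : Model) : q.2 ≤ ((D.T ^ n) q).2 := by
  induction n with
  | zero => exact le_rfl
  | succ n ih =>
    rw [T_pow_succ]
    refine ih.trans ?_
    change _ ≤ D.φ.1 ((D.T ^ n) q).2
    rcases eq_or_ne ((D.T ^ n) q).2 0 with h | h
    · rw [h]; exact zero_le
    · exact (D.expanding _ (pos_iff_ne_zero.2 h)).le

theorem T_pow_z2 (n : ℕ) (q : Model) : ((D.T ^ n) q).1.2 = D.mu ^ n * q.1.2 := by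
  induction n with
  | zero => simp
  | succ n ih =>
    rw [T_pow_succ]
    change D.mu * ((D.T ^ n) q).1.2 = _
    rw [ih]; ring

/-- Every point of `R̃` has a neighbourhood that is disjoint from its images under the positive
iterates of `T`. -/
theorem exists_wandering (q : Model) (hq : q ≠ 0) :
    ∃ U : Set Model, IsOpen U ∧ q ∈ U ∧ ∀ n : ℕ, ∀ r ∈ U, (D.T ^ (n + 1)) r ∉ U := by
  have hmu := D.one_lt_norm_mu
  have hlam := hmu.trans_le D.norm_mu_le
  obtain ⟨⟨z1, z2⟩, x⟩ := q
  rcases eq_or_ne x 0 with rfl | hx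
  · rcases eq_or_ne z2 0 with rfl | hz2
    · -- boundary points with `z₂ = 0`
      have hz1 : z1 ≠ 0 := by rintro rfl; exact hq rfl
      have hm : 0 < ‖z1‖ := norm_pos_iff.2 hz1
      set c : ℝ := (‖D.lam‖ - 1) / 2 with hc
      have hc0 : 0 < c := by rw [hc]; linarith
      set m : ℝ := ‖z1‖ / (1 + c / 2) with hmdef
      have hm0 : 0 < m := by positivity
      have hm1 : m < ‖z1‖ := by
        rw [hmdef, div_lt_iff₀ (by positivity)]; nlinarith
      have hm2 : ‖z1‖ < (1 + c) * m := by
        rw [hmdef, mul_div_assoc', lt_div_iff₀ (by positivity)]; nlinarith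
      -- a bound for `z₂` that makes the nonlinear term small
      obtain ⟨ε, hε0, hε⟩ : ∃ ε : ℝ, 0 < ε ∧ ∀ w : ℂ, ‖w‖ < ε → ‖D.tau * w ^ D.p‖ < c * m := by
        have hcont : Continuous fun w : ℂ => D.tau * w ^ D.p := by fun_prop
        obtain ⟨ε, hε0, h⟩ := Metric.continuous_iff.1 hcont 0 (c * m) (by positivity)
        refine ⟨ε, hε0, fun w hw => ?_⟩
        have := h w (by simpa using hw)
        simpa [D.p_pos.ne'] using this
      refine ⟨{r | m < ‖r.1.1‖ ∧ ‖r.1.1‖ < (1 + c) * m ∧ ‖r.1.2‖ < ε}, ?_,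
        ⟨hm1, hm2, by simpa using hε0⟩, ?_⟩
      · have o1 : IsOpen {r : Model | m < ‖r.1.1‖} := isOpen_lt (by fun_prop) (by fun_prop)
        have o2 : IsOpen {r : Model | ‖r.1.1‖ < (1 + c) * m} :=
          isOpen_lt (by fun_prop) (by fun_prop)
        have o3 : IsOpen {r : Model | ‖r.1.2‖ < ε} := isOpen_lt (by fun_prop) (by fun_prop)
        exact o1.inter (o2.inter o3)
      · rintro n r ⟨hr1, hr2, hr3⟩ ⟨hs1, hs2, hs3⟩
        have hsmall : ∀ k ≤ n, ‖((D.T ^ k) r).1.2‖ < ε := fun k hk => by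
          refine lt_of_le_of_lt ?_ hs3
          rw [T_pow_z2, T_pow_z2, norm_mul, norm_mul, norm_pow, norm_pow]
          gcongr
          · exact hmu.le
          · omega
        have step : ∀ k ≤ n, m < ‖((D.T ^ k) r).1.1‖ → (1 + c) * m < ‖((D.T ^ (k + 1)) r).1.1‖ := by
          intro k hk hkm
          rw [T_pow_succ]
          change _ < ‖D.lam * ((D.T ^ k) r).1.1 + D.tau * ((D.T ^ k) r).1.2 ^ D.p‖
          have h1 := hε _ (hsmall k hk)
          have h2 := norm_sub_le_norm_add (D.lam * ((D.T ^ k) r).1.1)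
            (D.tau * ((D.T ^ k) r).1.2 ^ D.p)
          rw [norm_mul] at h2
          have h3 : ‖D.lam‖ = 1 + 2 * c := by rw [hc]; ring
          rw [h3] at h2
          nlinarith
        have grow : ∀ k ≤ n, m < ‖((D.T ^ k) r).1.1‖ := by
          intro k
          induction k with
          | zero => intro _; exact hr1
          | succ k ih =>
            intro hk
            have := step k (by omega) (ih (by omega))
            nlinarith
        exact absurd hs2 (not_lt.2 (step n le_rfl (grow n le_rfl)).le)
    · -- boundary points with `z₂ ≠ 0`
      have hz : 0 < ‖z2‖ := norm_pos_iff.2 hz2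
      obtain ⟨t, ht1, ht2⟩ := exists_between hmu
      have ht0 : 0 < t := by linarith
      refine ⟨{r | ‖z2‖ / t < ‖r.1.2‖ ∧ ‖r.1.2‖ < ‖z2‖ / t * ‖D.mu‖}, ?_, ⟨?_, ?_⟩, ?_⟩
      · have o1 : IsOpen {r : Model | ‖z2‖ / t < ‖r.1.2‖} := isOpen_lt (by fun_prop) (by fun_prop)
        have o2 : IsOpen {r : Model | ‖r.1.2‖ < ‖z2‖ / t * ‖D.mu‖} :=
          isOpen_lt (by fun_prop) (by fun_prop)
        exact o1.inter o2
      · exact div_lt_self hz ht1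
      · change ‖z2‖ < ‖z2‖ / t * ‖D.mu‖
        rw [div_mul_eq_mul_div, lt_div_iff₀ ht0]
        gcongr
      · rintro n r ⟨hr1, hr2⟩ ⟨hs1, hs2⟩
        rw [T_pow_z2, norm_mul, norm_pow] at hs2
        have h1 : ‖D.mu‖ ≤ ‖D.mu‖ ^ (n + 1) := le_self_pow₀ hmu.le (by omega)
        have h2 : ‖z2‖ / t * ‖D.mu‖ ≤ ‖D.mu‖ ^ (n + 1) * ‖r.1.2‖ := by
          rw [mul_comm]
          gcongr
        linarith
  · -- interior points
    have hx0 : 0 < x := pos_iff_ne_zero.2 hx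
    have hlt : D.φ.1.symm x < x := by
      have h := D.expanding _ (homeo_pos D.φ.1.symm hx0)
      rwa [Homeomorph.apply_symm_apply] at h
    obtain ⟨a, ha1, ha2⟩ := exists_between hlt
    have ha0 : 0 < a := lt_of_le_of_lt zero_le ha1
    have hmono : StrictMono D.φ.1 := homeo_strictMono _
    refine ⟨{r | a < r.2 ∧ r.2 < D.φ.1 a}, ?_, ⟨ha2, ?_⟩, ?_⟩
    · have o1 : IsOpen {r : Model | a < r.2} := isOpen_lt (by fun_prop) (by fun_prop)
      have o2 : IsOpen {r : Model | r.2 < D.φ.1 a} := isOpen_lt (by fun_prop) (by fun_prop)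
      exact o1.inter o2
    · have h := hmono ha1
      rwa [Homeomorph.apply_symm_apply] at h
    · rintro n r ⟨hr1, hr2⟩ ⟨hs1, hs2⟩
      rw [T_pow_succ] at hs2
      have h : D.φ.1 a < D.φ.1 ((D.T ^ n) r).2 := hmono (hr1.trans_le (D.T_pow_snd_mono n r))
      exact lt_asymm h hs2

theorem isLocalHomeomorph_proj : IsLocalHomeomorph D.proj := by
  rw [isLocalHomeomorph_iff_isOpenEmbedding_restrict]
  intro q
  obtain ⟨U, hU, hqU, hw⟩ := D.exists_wandering q.1 q.2
  have hV : IsOpen (Subtype.val ⁻¹' U : Set D.Cover) := hU.preimage continuous_subtype_val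
  refine ⟨Subtype.val ⁻¹' U, hV.mem_nhds hqU, ?_⟩
  refine IsOpenEmbedding.of_continuous_injective_isOpenMap
    (D.continuous_proj.comp continuous_subtype_val) ?_
    (D.isOpenMap_proj.comp hV.isOpenMap_subtype_val)
  rintro ⟨r, hr⟩ ⟨s, hs⟩ h
  obtain ⟨n, hn⟩ := D.proj_eq_iff.1 h
  have hrs : r.1 = s.1 := by
    obtain ⟨k, rfl | rfl⟩ := n.eq_nat_or_neg
    · rw [zpow_natCast] at hn
      cases k with
      | zero => exact hn
      | succ k => exact absurd (hn ▸ hs) (hw k _ hr)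
    · have hn' : (D.T ^ k) s.1 = r.1 := by
        rw [← hn, ← zpow_natCast, ← Homeomorph.mul_apply, ← zpow_add, add_neg_cancel, zpow_zero]
        rfl
      cases k with
      | zero => exact hn'.symm
      | succ k => exact absurd (hn' ▸ hr) (hw k _ hs)
  exact Subtype.ext (Subtype.ext hrs)

theorem exists_chart (P : D.Reeb) : ∃ c : OpenPartialHomeomorph D.Reeb Model,
    P ∈ c.source ∧ ∀ q ∈ c.target, ∃ h : q ≠ 0, D.proj ⟨q, h⟩ = c.symm q := by
  obtain ⟨q, rfl⟩ : ∃ q, D.proj q = P := Quotient.exists_rep P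
  obtain ⟨e, hqe, he⟩ := D.isLocalHomeomorph_proj q
  have hemb : IsOpenEmbedding (Subtype.val : D.Cover → Model) :=
    isOpen_ne_zero.isOpenEmbedding_subtypeVal
  have : Nonempty D.Cover := ⟨q⟩
  refine ⟨e.symm ≫ₕ hemb.toOpenPartialHomeomorph _, ?_, ?_⟩
  · simpa [he] using e.map_source hqe
  · intro r hr
    simp only [OpenPartialHomeomorph.trans_target, IsOpenEmbedding.toOpenPartialHomeomorph_target,
      mem_inter_iff, mem_range] at hr
    obtain ⟨⟨s, rfl⟩, -⟩ := hr
    refine ⟨s.2, ?_⟩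
    have : (hemb.toOpenPartialHomeomorph Subtype.val).symm s.1 = s :=
      (hemb.toOpenPartialHomeomorph Subtype.val).left_inv (by simp)
    simp [this, ← he]

/-- The atlas of `R`: the charts are the local inverses of the projection `R̃ → R`, read in the
coordinates of `R̃ ⊂ ℂ² × [0, ∞)`. -/
instance : ChartedSpace Model D.Reeb where
  atlas := {c | ∀ q ∈ c.target, ∃ h : q ≠ 0, D.proj ⟨q, h⟩ = c.symm q}
  chartAt P := (D.exists_chart P).choose
  mem_chart_source P := (D.exists_chart P).choose_spec.1
  chart_mem_atlas P := (D.exists_chart P).choose_spec.2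

theorem leafwiseHolomorphicAt_prod {g : ℂ × ℂ → ℂ × ℂ} (hg : ContDiff ℝ ∞ g)
    (hg' : Differentiable ℂ g) {e : ℝ≥0 → ℝ≥0} (he : SmoothHalfLine e) (q : Model) :
    LeafwiseHolomorphicAt (fun r => (g r.1, e r.2)) q := by
  refine ⟨?_, univ, isOpen_univ, mem_univ _, ⟨e, fun _ _ => rfl⟩, fun x => hg'.differentiableOn⟩
  refine ContDiffWithinAt.prodMk (hg.comp contDiff_fst).contDiffWithinAt ?_
  have h : ContDiffWithinAt ℝ ∞ (fun x : ℝ => (e x.toNNReal : ℝ)) (Ici 0) (Model.toReal q).2 :=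
    he _ q.2.2
  refine h.comp (Model.toReal q) contDiff_snd.contDiffWithinAt ?_
  rintro _ ⟨r, rfl⟩
  exact r.2.2

theorem leafwiseHolomorphicAt_T (q : Model) : LeafwiseHolomorphicAt D.T q := by
  refine leafwiseHolomorphicAt_prod (g := D.G) ?_ ?_ D.φ.2.1 q
  · change ContDiff ℝ ∞ fun z : ℂ × ℂ => (D.lam * z.1 + D.tau * z.2 ^ D.p, D.mu * z.2)
    fun_prop
  · change Differentiable ℂ fun z : ℂ × ℂ => (D.lam * z.1 + D.tau * z.2 ^ D.p, D.mu * z.2)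
    fun_prop

theorem leafwiseHolomorphicAt_T_symm (q : Model) : LeafwiseHolomorphicAt D.T.symm q := by
  refine leafwiseHolomorphicAt_prod (g := D.G.symm) ?_ ?_ D.φ.2.2 q
  · change ContDiff ℝ ∞ fun w : ℂ × ℂ =>
      (D.lam⁻¹ * (w.1 - D.tau * (D.mu⁻¹ * w.2) ^ D.p), D.mu⁻¹ * w.2)
    fun_prop
  · change Differentiable ℂ fun w : ℂ × ℂ =>
      (D.lam⁻¹ * (w.1 - D.tau * (D.mu⁻¹ * w.2) ^ D.p), D.mu⁻¹ * w.2)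
    fun_prop

theorem leafwiseHolomorphicAt_T_zpow (n : ℤ) (q : Model) :
    LeafwiseHolomorphicAt (D.T ^ n : Model ≃ₜ Model) q := by
  induction n generalizing q with
  | zero => exact LeafwiseHolomorphicAt.id q
  | succ n ih =>
    rw [zpow_add_one]
    exact (ih (D.T q)).comp (D.leafwiseHolomorphicAt_T q) isOpen_univ (mem_univ q)
      D.T.continuous.continuousOn
  | pred n ih =>
    rw [zpow_sub_one]
    exact (ih (D.T.symm q)).comp (D.leafwiseHolomorphicAt_T_symm q) isOpen_univ (mem_univ q)
      D.T.symm.continuous.continuousOn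

/-- `R` is a manifold with a leafwise complex foliation. -/
instance : HasGroupoid D.Reeb leafwiseGroupoid := by
  refine hasGroupoid_of_pregroupoid leafwisePregroupoid fun {c c'} hc hc' => ?_
  refine ⟨(c.symm ≫ₕ c').continuousOn, fun q hq => ?_⟩
  simp only [OpenPartialHomeomorph.trans_source, OpenPartialHomeomorph.symm_source, mem_inter_iff,
    mem_preimage] at hq
  obtain ⟨h0, h1⟩ := hc q hq.1
  obtain ⟨h0', h1'⟩ := hc' _ (c'.map_source hq.2)
  obtain ⟨n, hn⟩ := D.proj_eq_iff.1 (h1.trans ((c'.left_inv hq.2).symm.trans h1'.symm))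
  -- near `q`, the coordinate change is `T ^ n`
  refine (D.leafwiseHolomorphicAt_T_zpow n q).congr
    (s := c.target ∩ (D.T ^ n : Model ≃ₜ Model) ⁻¹' c'.target)
    (c.open_target.inter (c'.open_target.preimage (D.T ^ n).continuous)) ⟨hq.1, ?_⟩ ?_
  · change (D.T ^ n) q ∈ c'.target
    rw [hn]
    exact c'.map_source hq.2
  · rintro r ⟨hr, hr'⟩
    obtain ⟨k0, k1⟩ := hc r hr
    obtain ⟨k0', k1'⟩ := hc' _ hr'
    have : D.proj ⟨r, k0⟩ = D.proj ⟨(D.T ^ n) r, k0'⟩ := D.proj_eq_iff.2 ⟨n, rfl⟩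
    change c' (c.symm r) = (D.T ^ n) r
    rw [← k1, this, k1', c'.right_inv hr']

/-- The boundary `H = (ℂ² ∖ {O}) × {0} / T^ℤ` of `R`, a primary Hopf surface. -/
def boundary : Set D.Reeb := D.proj '' {q | q.1.2 = 0}

/-- `Aut(R, H)`: the leafwise holomorphic smooth automorphisms of `R` whose restriction to the
boundary `H` is the identity. -/
def AutRelBoundary : Subgroup (D.Reeb ≃ₜ D.Reeb) where
  carrier := {f | f ∈ LeafwiseAut D.Reeb ∧ ∀ P ∈ D.boundary, f P = P}
  mul_mem' {f g} hf hg := ⟨mul_mem hf.1 hg.1, fun P hP => by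
    rw [Homeomorph.mul_apply, hg.2 P hP, hf.2 P hP]⟩
  one_mem' := ⟨one_mem _, fun _ _ => rfl⟩
  inv_mem' {f} hf := ⟨inv_mem hf.1, fun P hP => by
    change f.symm P = P
    rw [Homeomorph.symm_apply_eq, hf.2 P hP]⟩

end HopfData
end LCReeb
end

namespace LCReeb

open Filter

/-! ## Iterates of an expanding map of the half line -/

/-! The work is done on the covering R̃, where τ = 0 and λ = μ make T the product of the scalar λ
and φ.

From pairs to automorphisms. The map (z, x) ↦ (z + β(η x), η x) commutes with T because η commutes
with φ and β ∘ φ = λβ, so it descends to R. The issue is smoothness at x = 0, about which the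
definition of a solution says nothing. Differentiating the functional equation k times gives λ β⁽ᵏ⁾
= (φ')ᵏ · β⁽ᵏ⁾ ∘ φ + terms in lower derivatives of β at φ(x). Since φ'(0) = 1 and |λ| > 1, near 0
the size of β⁽ᵏ⁾ contracts along backward orbits of φ, up to an error that tends to 0 by induction
on k. So every derivative tends to 0 and β extends smoothly by zero (`contDiff_extendZero`).

From automorphisms to pairs. R̃ is contractible, so an automorphism fixing H has a lift F, which can
be chosen to fix the boundary of R̃ pointwise and then commutes with every Tⁿ. Its transverse
component depends on x alone. For fixed x > 0, a point (z, x) with |z| large is Tⁿ(w, y) with 1 ≤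
|w| ≤ |λ| and y close to 0, where F is close to the identity. Equivariance gives |F(z, x) - z| =
|λ|ⁿ |F(w, y) - w| = o(|z|), with F(z, x) standing for its ℂ²-component (`exists_norm_sub_le`). By
Liouville's theorem F is a translation on each leaf, and equivariance makes the translation vector a
pair of solutions. Injectivity is uniqueness of lifts.

Solutions can be prescribed freely on compactly supported data in the fundamental domain (1, φ(1))
and extended equivariantly, which makes the space infinite dimensional. -/

theorem exists_le_iterate {P : ℝ → ℝ} (hP : Continuous P) (hlt : ∀ x, 0 < x → x < P x)
    {a : ℝ} (ha : 0 < a) (b : ℝ) : ∃ n : ℕ, b ≤ P^[n] a := by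
  by_contra! h
  have hpos : ∀ n : ℕ, a ≤ P^[n] a := by
    intro n
    induction n with
    | zero => exact le_rfl
    | succ n ih =>
      rw [Function.iterate_succ_apply']
      exact ih.trans (hlt _ (ha.trans_le ih)).le
  have hmono : Monotone fun n : ℕ => P^[n] a := by
    refine monotone_nat_of_le_succ fun n => ?_
    rw [Function.iterate_succ_apply']
    exact (hlt _ (ha.trans_le (hpos n))).le
  -- A bounded orbit would increase to a fixed point of P that is at least a > 0, and P has none.
  have hlim := tendsto_atTop_ciSup hmono ⟨b, by rintro _ ⟨n, rfl⟩; exact (h n).le⟩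
  have hfix := isFixedPt_of_tendsto_iterate hlim hP.continuousAt
  have : a ≤ ⨆ n : ℕ, P^[n] a := ge_of_tendsto' hlim hpos
  exact (hlt _ (ha.trans_le this)).ne' hfix

/-- A function on `(0, ∞)` that contracts under an expanding change of variables, up to an error
that tends to zero, tends to zero at `0`. -/
theorem tendsto_zero_of_norm_le_contraction {P : ℝ → ℝ} (hP : Continuous P) (hmono : Monotone P)
    (h0 : P 0 = 0) (hlt : ∀ x, 0 < x → x < P x) {g r : ℝ → ℂ} (hg : ContinuousOn g (Ioi 0))
    (hr : Tendsto r (𝓝[>] 0) (𝓝 0)) {c : ℝ} (hc0 : 0 ≤ c) (hc1 : c < 1)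
    (h : ∀ᶠ x in 𝓝[>] 0, ‖g x‖ ≤ c * ‖g (P x)‖ + ‖r x‖) :
    Tendsto g (𝓝[>] 0) (𝓝 0) := by
  have hPlim : Tendsto P (𝓝[>] 0) (𝓝[>] 0) := by
    refine tendsto_nhdsWithin_iff.2 ⟨?_, ?_⟩
    · simpa [h0] using (hP.tendsto 0).mono_left nhdsWithin_le_nhds
    · filter_upwards [self_mem_nhdsWithin] with x hx
      exact (mem_Ioi.1 hx).trans (hlt x hx)
  have key : ∀ e : ℝ, 0 < e → ∀ᶠ x in 𝓝[>] 0, ‖g x‖ ≤ c * ‖g (P x)‖ + e := by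
    intro e he
    filter_upwards [h, hr.norm.eventually_lt_const (by simpa using he)] with x h1 h2
    linarith
  -- A bound near 0 comes first: every small x reaches the compact interval [d', P d'] under
  -- iteration, and a bound there is carried back along the orbit.
  have bdd : ∃ K : ℝ, ∀ᶠ x in 𝓝[>] 0, ‖g x‖ ≤ K := by
    obtain ⟨d, hd, hd'⟩ := (mem_nhdsGT_iff_exists_Ioo_subset).1 (key 1 one_pos)
    obtain ⟨d', hd0, hdd⟩ := exists_between (mem_Ioi.1 hd)
    have hcomp : IsCompact (Icc d' (P d')) := isCompact_Icc
    obtain ⟨M, hM⟩ := hcomp.exists_bound_of_continuousOn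
      (hg.mono fun x hx => hd0.trans_le hx.1)
    -- The term 1 / (1 - c) makes K stable under t ↦ c t + 1.
    set K := max M (1 / (1 - c)) with hK
    have hK1 : c * K + 1 ≤ K := by
      have h1 : 1 / (1 - c) ≤ K := le_max_right _ _
      rw [div_le_iff₀ (by linarith)] at h1
      linarith
    have main : ∀ n : ℕ, ∀ x : ℝ, 0 < x → x < d' → d' ≤ P^[n] x → ‖g x‖ ≤ K := by
      intro n
      induction n with
      | zero => intro x _ h1 h2; exact absurd h1 (not_lt.2 h2)
      | succ n ih =>
        intro x hx h1 h2
        have hPx : ‖g (P x)‖ ≤ K := by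
          rcases lt_or_ge (P x) d' with h3 | h3
          · exact ih _ (hx.trans (hlt x hx)) h3 h2
          · exact (hM _ ⟨h3, hmono h1.le⟩).trans (le_max_left _ _)
        have h4 : ‖g x‖ ≤ c * ‖g (P x)‖ + 1 := hd' ⟨hx, h1.trans hdd⟩
        have h5 : c * ‖g (P x)‖ ≤ c * K := by gcongr
        linarith
    refine ⟨K, ?_⟩
    filter_upwards [Ioo_mem_nhdsGT hd0] with x hx
    obtain ⟨n, hn⟩ := exists_le_iterate hP hlt hx.1 d'
    exact main n x hx.1 hx.2 hn
  obtain ⟨K, hK⟩ := bdd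
  rw [tendsto_zero_iff_norm_tendsto_zero]
  refine tendsto_order.2 ⟨fun a ha => Eventually.of_forall fun x => ha.trans_le (norm_nonneg _),
    fun e he => ?_⟩
  -- Iterating the contraction turns the bound into a limit. The error e / 2 * (1 - c) is chosen so
  -- that e / 2 is the fixed point of t ↦ c t + e / 2 * (1 - c).
  have step : ∀ n : ℕ, ∀ᶠ x in 𝓝[>] 0, ‖g x‖ ≤ c ^ n * K + e / 2 := by
    intro n
    induction n with
    | zero =>
      filter_upwards [hK] with x hx
      simp; linarith
    | succ n ih =>
      filter_upwards [hPlim.eventually ih, key (e / 2 * (1 - c)) (by nlinarith)] with x h1 h2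
      have h3 : c * ‖g (P x)‖ ≤ c * (c ^ n * K + e / 2) := by gcongr
      rw [pow_succ]
      linarith
  have hlim : Tendsto (fun n : ℕ => c ^ n * K + e / 2) atTop (𝓝 (e / 2)) := by
    simpa using ((tendsto_pow_atTop_nhds_zero_of_lt_one hc0 hc1).mul_const K).add_const (e / 2)
  obtain ⟨n, hn⟩ := (hlim.eventually_lt_const (half_lt_self he)).exists
  filter_upwards [step n] with x hx
  exact hx.trans_lt hn

/-! ## Flatness of the solutions of the functional equation -/

theorem hasDerivAt_iteratedDeriv {g : ℝ → ℂ} {x : ℝ} (hg : ContDiffAt ℝ ∞ g x) (k : ℕ) :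
    HasDerivAt (iteratedDeriv k g) (iteratedDeriv (k + 1) g x) x := by
  have h := hg.contDiffWithinAt.differentiableWithinAt_iteratedDerivWithin (m := k) (s := univ)
    (by exact_mod_cast WithTop.coe_lt_coe.2 (ENat.natCast_lt_top k)) (by simp)
  rw [iteratedDerivWithin_univ, differentiableWithinAt_univ] at h
  rw [iteratedDeriv_succ]
  exact h.hasDerivAt

/-- The functions of the form `∑ aᵢ(x) g⁽ⁱ⁾(P x)`, `i < k`, with `aᵢ` smooth on `[0, ∞)`. -/
inductive IsJetCombination (P : ℝ → ℝ) (g : ℝ → ℂ) : ℕ → (ℝ → ℂ) → Prop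
  | zero (k : ℕ) : IsJetCombination P g k fun _ => 0
  | term {k i : ℕ} (hi : i < k) {a : ℝ → ℝ} (ha : ContDiffOn ℝ ∞ a (Ici 0)) :
      IsJetCombination P g k fun x => (a x : ℂ) * iteratedDeriv i g (P x)
  | add {k : ℕ} {r s : ℝ → ℂ} (hr : IsJetCombination P g k r) (hs : IsJetCombination P g k s) :
      IsJetCombination P g k fun x => r x + s x

namespace IsJetCombination

variable {P : ℝ → ℝ} {g : ℝ → ℂ}

theorem tendsto_zero {k : ℕ} {r : ℝ → ℂ} (hr : IsJetCombination P g k r)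
    (hP : Tendsto P (𝓝[>] 0) (𝓝[>] 0))
    (hg : ∀ i < k, Tendsto (iteratedDeriv i g) (𝓝[>] 0) (𝓝 0)) : Tendsto r (𝓝[>] 0) (𝓝 0) := by
  induction hr with
  | zero => exact tendsto_const_nhds
  | @term i hi a ha =>
    have h1 : Tendsto a (𝓝[>] 0) (𝓝 (a 0)) :=
      (ha.continuousOn 0 self_mem_Ici).mono_left (nhdsWithin_mono _ Ioi_subset_Ici_self)
    have h2 : Tendsto (fun x => (a x : ℂ)) (𝓝[>] 0) (𝓝 (a 0 : ℂ)) :=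
      (Complex.continuous_ofReal.tendsto _).comp h1
    simpa using h2.mul ((hg i hi).comp hP)
  | add _ _ h1 h2 => simpa using h1.add h2

/-- By the product and chain rules, differentiation raises the order of the derivatives of g by at
most one and keeps the coefficients smooth up to 0. -/
theorem exists_hasDerivAt {k : ℕ} {r : ℝ → ℂ} (hr : IsJetCombination P g k r)
    (hP : ContDiffOn ℝ ∞ P (Ici 0)) (hPpos : ∀ x, 0 < x → 0 < P x)
    (hg : ContDiffOn ℝ ∞ g (Ioi 0)) :
    ∃ r', IsJetCombination P g (k + 1) r' ∧ ∀ x, 0 < x → HasDerivAt r (r' x) x := by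
  induction hr with
  | zero => exact ⟨_, .zero _, fun x _ => hasDerivAt_const x 0⟩
  | @term i hi a ha =>
    have huniq : UniqueDiffOn ℝ (Ici (0 : ℝ)) := uniqueDiffOn_Ici 0
    have ha' : ContDiffOn ℝ ∞ (derivWithin a (Ici 0)) (Ici 0) := ha.derivWithin huniq (by simp)
    have hP' : ContDiffOn ℝ ∞ (derivWithin P (Ici 0)) (Ici 0) := hP.derivWithin huniq (by simp)
    refine ⟨_, .add (.term (i := i) (by omega) ha')
      (.term (i := i + 1) (by omega) (ha.mul hP')), fun x hx => ?_⟩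
    have da : HasDerivAt a (derivWithin a (Ici 0) x) x :=
      ((ha.differentiableOn (by simp)) x hx.le).hasDerivWithinAt.hasDerivAt (Ici_mem_nhds hx)
    have dP : HasDerivAt P (derivWithin P (Ici 0) x) x :=
      ((hP.differentiableOn (by simp)) x hx.le).hasDerivWithinAt.hasDerivAt (Ici_mem_nhds hx)
    have dg : HasDerivAt (iteratedDeriv i g) (iteratedDeriv (i + 1) g (P x)) (P x) := by
      have hc : ContDiffAt ℝ ∞ g (P x) := hg.contDiffAt (Ioi_mem_nhds (hPpos x hx))
      exact hasDerivAt_iteratedDeriv hc i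
    have := da.ofReal_comp.mul (dg.scomp x dP)
    refine this.congr_deriv ?_
    simp only [Function.comp_apply, Complex.real_smul, Complex.ofReal_mul]
    ring
  | add _ _ h1 h2 =>
    obtain ⟨r', hr', h1⟩ := h1
    obtain ⟨s', hs', h2⟩ := h2
    exact ⟨_, .add hr' hs', fun x hx => (h1 x hx).add (h2 x hx)⟩

end IsJetCombination

/-- Differentiating `g (P x) = lam * g x` repeatedly. -/
theorem exists_isJetCombination {P : ℝ → ℝ} {g : ℝ → ℂ} {lam : ℂ}
    (hP : ContDiffOn ℝ ∞ P (Ici 0)) (hPpos : ∀ x, 0 < x → 0 < P x)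
    (hg : ContDiffOn ℝ ∞ g (Ioi 0)) (heq : ∀ x, 0 < x → g (P x) = lam * g x) (k : ℕ) :
    ∃ r, IsJetCombination P g k r ∧ ∀ x, 0 < x → lam * iteratedDeriv k g x =
      ((derivWithin P (Ici 0) x ^ k : ℝ) : ℂ) * iteratedDeriv k g (P x) + r x := by
  induction k with
  | zero => exact ⟨_, .zero _, fun x hx => by simp [heq x hx]⟩
  | succ k ih =>
    obtain ⟨r, hr, h⟩ := ih
    have hP' : ContDiffOn ℝ ∞ (derivWithin P (Ici 0)) (Ici 0) :=
      hP.derivWithin (uniqueDiffOn_Ici 0) (by simp)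
    have hP'' : ContDiffOn ℝ ∞ (fun x => derivWithin P (Ici 0) x ^ k) (Ici 0) := hP'.pow k
    obtain ⟨r', hr', hd⟩ := hr.exists_hasDerivAt hP hPpos hg
    have hP''' := hP''.derivWithin (m := ∞) (uniqueDiffOn_Ici 0) (by simp)
    -- The derivative of the coefficient (P')ᵏ multiplies g⁽ᵏ⁾ ∘ P, which is of lower order at stage
    -- k + 1 and joins the remainder.
    refine ⟨_, .add (.term (i := k) (by omega) hP''') hr', fun x hx => ?_⟩
    have dg : ∀ y, 0 < y → HasDerivAt (iteratedDeriv k g) (iteratedDeriv (k + 1) g y) y := by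
      intro y hy
      have hc : ContDiffAt ℝ ∞ g y := hg.contDiffAt (Ioi_mem_nhds hy)
      exact hasDerivAt_iteratedDeriv hc k
    have da : HasDerivAt (fun x => derivWithin P (Ici 0) x ^ k)
        (derivWithin (fun x => derivWithin P (Ici 0) x ^ k) (Ici 0) x) x :=
      ((hP''.differentiableOn (by simp)) x hx.le).hasDerivWithinAt.hasDerivAt (Ici_mem_nhds hx)
    have dP : HasDerivAt P (derivWithin P (Ici 0) x) x :=
      ((hP.differentiableOn (by simp)) x hx.le).hasDerivWithinAt.hasDerivAt (Ici_mem_nhds hx)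
    have d1 := (dg x hx).const_mul lam
    have d2 := (da.ofReal_comp.mul ((dg (P x) (hPpos x hx)).scomp x dP)).add (hd x hx)
    have d3 : HasDerivAt (fun x => lam * iteratedDeriv k g x) _ x :=
      d2.congr_of_eventuallyEq <| by
        filter_upwards [Ioi_mem_nhds hx] with y hy
        exact h y hy
    rw [d1.unique d3]
    simp only [Function.comp_apply, Complex.real_smul, Complex.ofReal_pow]
    ring

/-- A smooth function on `(0, ∞)` all of whose derivatives tend to zero at `0` extends smoothly
by zero. -/
theorem contDiff_of_tendsto_iteratedDeriv {g : ℝ → ℂ} (hg : ContDiffOn ℝ ∞ g (Ioi 0))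
    (hneg : ∀ x ≤ 0, g x = 0) (hlim : ∀ k, Tendsto (iteratedDeriv k g) (𝓝[>] 0) (𝓝 0)) :
    ContDiff ℝ ∞ g := by
  -- H k is the candidate for the k-th derivative on all of ℝ. The only point to check is 0, where
  -- continuity of H k and H (k + 1) yields differentiability.
  set H : ℕ → ℝ → ℂ := fun k x => if 0 < x then iteratedDeriv k g x else 0 with hH
  have hcont : ∀ k, ContinuousAt (H k) 0 := by
    intro k
    have h0 : H k 0 = 0 := by simp [hH]
    rw [continuousAt_iff_continuous_left'_right']
    constructor
    · refine (tendsto_const_nhds (x := (0 : ℂ))).congr' ?_ |>.trans_eq (by rw [h0])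
      filter_upwards [self_mem_nhdsWithin] with x hx
      simp [hH, not_lt.2 (le_of_lt (mem_Iio.1 hx))]
    · rw [ContinuousWithinAt, h0]
      refine (hlim k).congr' ?_
      filter_upwards [self_mem_nhdsWithin] with x hx
      simp [hH, mem_Ioi.1 hx]
  have hne : ∀ k x, x ≠ 0 → HasDerivAt (H k) (H (k + 1) x) x := by
    intro k x hx
    rcases lt_or_gt_of_ne hx with hx | hx
    · have h1 : H (k + 1) x = 0 := by simp [hH, hx.le]
      rw [h1]
      refine (hasDerivAt_const x (0 : ℂ)).congr_of_eventuallyEq ?_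
      filter_upwards [Iio_mem_nhds hx] with y hy
      simp [hH, le_of_lt (mem_Iio.1 hy)]
    · have hc : ContDiffAt ℝ ∞ g x := hg.contDiffAt (Ioi_mem_nhds hx)
      have h1 : H (k + 1) x = iteratedDeriv (k + 1) g x := if_pos hx
      rw [h1]
      refine (hasDerivAt_iteratedDeriv hc k).congr_of_eventuallyEq ?_
      filter_upwards [Ioi_mem_nhds hx] with y hy
      simp [hH, mem_Ioi.1 hy]
  have hderiv : ∀ k x, HasDerivAt (H k) (H (k + 1) x) x := by
    intro k x
    rcases eq_or_ne x 0 with rfl | hx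
    · exact hasDerivAt_of_hasDerivAt_of_ne (hne k) (hcont k) (hcont (k + 1))
    · exact hne k x hx
  have hsmooth : ∀ n k : ℕ, ContDiff ℝ n (H k) := by
    intro n
    induction n with
    | zero =>
      intro k
      exact contDiff_zero.2 (continuous_iff_continuousAt.2 fun x => (hderiv k x).continuousAt)
    | succ n ih =>
      intro k
      push_cast
      refine contDiff_succ_iff_deriv.2
        ⟨fun x => (hderiv k x).differentiableAt, by simp, ?_⟩
      rw [funext fun x => (hderiv k x).deriv]
      exact ih (k + 1)
  have hg0 : g = H 0 := by
    ext x
    by_cases hx : 0 < x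
    · simp [hH, hx]
    · simp [hH, hx, hneg x (not_lt.1 hx)]
  rw [hg0]
  exact contDiff_infty.2 fun n => hsmooth n 0

variable {φ : HalfLineDiffeo}

theorem InfinitelyTangentToId.derivWithin_eq_one (hφ : InfinitelyTangentToId φ) :
    derivWithin (fun x : ℝ => (φ.1 x.toNNReal : ℝ)) (Ici 0) 0 = 1 := by
  have h := hφ 1
  have hd : DifferentiableWithinAt ℝ (fun x : ℝ => (φ.1 x.toNNReal : ℝ)) (Ici 0) 0 :=
    (ContDiffOn.differentiableOn φ.2.1 (by simp)) 0 self_mem_Ici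
  have hu : UniqueDiffWithinAt ℝ (Ici (0 : ℝ)) 0 := uniqueDiffOn_Ici 0 0 self_mem_Ici
  rw [iteratedDerivWithin_one] at h
  have h2 := (hd.hasDerivWithinAt.sub (hasDerivWithinAt_id (0 : ℝ) (Ici 0))).derivWithin hu
  have h3 : derivWithin (fun x : ℝ => (φ.1 x.toNNReal : ℝ)) (Ici 0) 0 - 1 = 0 := h2.symm.trans h
  linarith

/-- If `φ` is tangent to the identity at `0`, the solutions of `β (φ x) = lam * β x`, `1 < |lam|`,
are flat at `0`. -/
theorem contDiff_extendZero (hφ : InfinitelyTangentToId φ) (hexp : ∀ x : ℝ≥0, 0 < x → x < φ.1 x)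
    {lam : ℂ} (hlam : 1 < ‖lam‖) (β : Sol φ lam) :
    ContDiff ℝ ∞ fun x : ℝ => extendZero β.1 x.toNNReal := by
  set P : ℝ → ℝ := fun x => (φ.1 x.toNNReal : ℝ) with hPdef
  have hPs : ContDiffOn ℝ ∞ P (Ici 0) := φ.2.1
  have hPc : Continuous P := NNReal.continuous_coe.comp (φ.1.continuous.comp continuous_real_toNNReal)
  have hPm : Monotone P := fun x y hxy =>
    NNReal.coe_le_coe.2 ((homeo_strictMono φ.1).monotone (Real.toNNReal_mono hxy))
  have hP0 : P 0 = 0 := by simp [hPdef, homeo_map_zero]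
  have hPlt : ∀ x, 0 < x → x < P x := fun x hx => by
    have := NNReal.coe_lt_coe.2 (hexp _ (Real.toNNReal_pos.2 hx))
    rwa [Real.coe_toNNReal _ hx.le] at this
  have hPpos : ∀ x, 0 < x → 0 < P x := fun x hx => hx.trans (hPlt x hx)
  have hPlim : Tendsto P (𝓝[>] 0) (𝓝[>] 0) := by
    refine tendsto_nhdsWithin_iff.2 ⟨?_, ?_⟩
    · simpa [hP0] using (hPc.tendsto 0).mono_left nhdsWithin_le_nhds
    · filter_upwards [self_mem_nhdsWithin] with x hx
      exact hPpos x hx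
  set g : ℝ → ℂ := fun x => extendZero β.1 x.toNNReal with hgdef
  have hg : ContDiffOn ℝ ∞ g (Ioi 0) := β.2.1
  have heq : ∀ x, 0 < x → g (P x) = lam * g x := fun x hx => by
    have hx' : 0 < x.toNNReal := Real.toNNReal_pos.2 hx
    have := homeo_pos φ.1 hx'
    simpa [hgdef, hPdef, extendZero, hx', this, onPos, -Real.toNNReal_pos]
      using β.2.2 ⟨x.toNNReal, hx'⟩
  refine contDiff_of_tendsto_iteratedDeriv hg (fun x hx => by
    simp only [hgdef, extendZero, Real.toNNReal_of_nonpos hx, lt_self_iff_false, dif_neg,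
      not_false_eq_true]) fun k => ?_
  induction k using Nat.strong_induction_on with
  | _ k ih =>
    obtain ⟨r, hr, h⟩ := exists_isJetCombination hPs hPpos hg heq k
    have hlam0 : lam ≠ 0 := by
      rintro rfl
      simp at hlam
      linarith
    -- P'(0) = 1, so the contraction factor |P'|ᵏ / |λ| tends to 1 / |λ| < 1 whatever k is; any c
    -- strictly between 1 / |λ| and 1 serves near 0.
    have hlim : Tendsto (fun x => |derivWithin P (Ici 0) x| ^ k / ‖lam‖) (𝓝[>] 0)
        (𝓝 (1 / ‖lam‖)) := by
      have hc : ContinuousWithinAt (derivWithin P (Ici 0)) (Ici 0) 0 :=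
        (hPs.derivWithin (m := ∞) (uniqueDiffOn_Ici 0) (by simp)).continuousOn 0 self_mem_Ici
      have := (hc.mono Ioi_subset_Ici_self).tendsto
      rw [hφ.derivWithin_eq_one] at this
      simpa using (this.abs.pow k).div_const ‖lam‖
    have hone : 1 / ‖lam‖ < 1 := by rw [div_lt_one (by linarith)]; exact hlam
    obtain ⟨c, hc0, hc1⟩ := exists_between hone
    have hr0 : Tendsto (fun x => lam⁻¹ * r x) (𝓝[>] 0) (𝓝 0) := by
      simpa using (hr.tendsto_zero hPlim ih).const_mul lam⁻¹
    have hgk : ContinuousOn (iteratedDeriv k g) (Ioi 0) := fun x hx =>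
      (hasDerivAt_iteratedDeriv (hg.contDiffAt (Ioi_mem_nhds hx)) k).continuousAt.continuousWithinAt
    refine tendsto_zero_of_norm_le_contraction hPc hPm hP0 hPlt hgk hr0
      ((by positivity : (0 : ℝ) ≤ 1 / ‖lam‖).trans hc0.le) hc1 ?_
    filter_upwards [hlim.eventually_lt_const hc0, self_mem_nhdsWithin] with x h1 h2
    have h3 : iteratedDeriv k g x = lam⁻¹ * (((derivWithin P (Ici 0) x ^ k : ℝ) : ℂ) *
        iteratedDeriv k g (P x)) + lam⁻¹ * r x := by
      rw [← mul_add, ← h x h2, inv_mul_cancel_left₀ hlam0]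
    rw [h3]
    refine (norm_add_le _ _).trans (add_le_add_left ?_ _)
    rw [← mul_assoc, norm_mul]
    refine mul_le_mul_of_nonneg_right ?_ (norm_nonneg _)
    rw [norm_mul, norm_inv, Complex.norm_real, Real.norm_eq_abs, abs_pow, inv_mul_eq_div]
    exact h1.le

end LCReeb

noncomputable section

namespace LCReeb

open Filter

/-! ## The space of solutions is infinite dimensional -/

section Bump

variable {φ : HalfLineDiffeo}

theorem strictMono_zpow (hexp : ∀ x : ℝ≥0, 0 < x → x < φ.1 x) {x : ℝ≥0} (hx : 0 < x) :
    StrictMono fun m : ℤ => (φ ^ m).1 x := by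
  refine strictMono_int_of_lt_succ fun m => ?_
  rw [add_comm, zpow_add, zpow_one]
  exact hexp _ (homeo_pos _ hx)

theorem zpow_add_one_apply (m : ℤ) (x : ℝ≥0) : (φ ^ (m + 1)).1 x = (φ ^ m).1 (φ.1 x) := by
  rw [zpow_add_one]; rfl

theorem exists_le_pow (hexp : ∀ x : ℝ≥0, 0 < x → x < φ.1 x) {a : ℝ≥0} (ha : 0 < a) (b : ℝ≥0) :
    ∃ n : ℕ, b ≤ (φ ^ n).1 a := by
  have hP : Continuous fun x : ℝ => (φ.1 x.toNNReal : ℝ) :=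
    NNReal.continuous_coe.comp (φ.1.continuous.comp continuous_real_toNNReal)
  obtain ⟨n, hn⟩ := exists_le_iterate hP (fun x hx => by
    have := NNReal.coe_lt_coe.2 (hexp _ (Real.toNNReal_pos.2 hx))
    rwa [Real.coe_toNNReal _ hx.le] at this) (NNReal.coe_pos.2 ha) b
  have hit : ∀ n : ℕ, (fun x : ℝ => (φ.1 x.toNNReal : ℝ))^[n] a = ((φ ^ n).1 a : ℝ≥0) := by
    intro n
    induction n with
    | zero => simp
    | succ n ih =>
      rw [Function.iterate_succ_apply', ih, pow_succ']
      simp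
  rw [hit] at hn
  exact ⟨n, NNReal.coe_le_coe.1 hn⟩

/-- Every orbit of `φ` in `(0, ∞)` meets the fundamental domain `[a, φ a)`. -/
theorem exists_zpow_mem_Ico (hexp : ∀ x : ℝ≥0, 0 < x → x < φ.1 x) {a x : ℝ≥0} (ha : 0 < a)
    (hx : 0 < x) : ∃ m : ℤ, a ≤ (φ ^ m).1 x ∧ (φ ^ m).1 x < φ.1 a := by
  have hmono := strictMono_zpow hexp hx
  obtain ⟨n, hn⟩ := exists_le_pow hexp hx a
  obtain ⟨k, hk⟩ := exists_le_pow hexp ha x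
  -- Exponents m with a ≤ φᵐ x are bounded below because φᵏ a ≥ x for some k; the least one puts x
  -- in the fundamental domain.
  have hbdd : ∀ m : ℤ, a ≤ (φ ^ m).1 x → -(k : ℤ) ≤ m := by
    intro m hm
    by_contra! hlt
    have h1 : (φ ^ (-(k : ℤ))).1 x ≤ a := by
      rw [zpow_neg, zpow_natCast]
      change (φ ^ k).1.symm x ≤ a
      have := (homeo_strictMono (φ ^ k).1.symm).monotone hk
      rwa [Homeomorph.symm_apply_apply] at this
    exact absurd (hm.trans_lt ((hmono hlt).trans_le h1)) (lt_irrefl _)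
  obtain ⟨m, hm, hleast⟩ := Int.exists_least_of_bdd (P := fun m => a ≤ (φ ^ m).1 x)
    ⟨_, hbdd⟩ ⟨n, by rwa [zpow_natCast]⟩
  refine ⟨m, hm, ?_⟩
  by_contra! h
  have h2 : a ≤ (φ ^ (m - 1)).1 x := by
    have h3 : φ.1 ((φ ^ (m - 1)).1 x) = (φ ^ m).1 x := by
      have : φ ^ m = φ * φ ^ (m - 1) := by rw [← zpow_one_add]; congr 1; omega
      rw [this]; rfl
    rw [← h3] at h
    exact (homeo_strictMono φ.1).le_iff_le.1 h
  have := hleast _ h2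
  omega

/-- The equivariant extension of a function supported in a fundamental domain. -/
def periodize (φ : HalfLineDiffeo) (lam : ℂ) (f : ℝ → ℝ) (x : ℝ≥0) : ℂ :=
  ∑ᶠ m : ℤ, lam ^ (-m) * (f ((φ ^ m).1 x) : ℂ)

variable {lam : ℂ} {f : ℝ → ℝ} {a : ℝ≥0}

/-- Shifting the summation index by one trades φ for the factor λ. -/
theorem periodize_map (hlam : lam ≠ 0) (x : ℝ≥0) :
    periodize φ lam f (φ.1 x) = lam * periodize φ lam f x := by
  unfold periodize
  rw [eq_comm, ← smul_eq_mul, smul_finsum, ← finsum_comp_equiv (Equiv.addRight (1 : ℤ))]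
  refine finsum_congr fun m => ?_
  have h : lam * lam ^ (-(m + 1)) = lam ^ (-m) := by
    rw [← zpow_one_add₀ hlam]
    congr 1
    ring
  rw [Equiv.coe_addRight, zpow_add_one_apply, smul_eq_mul, ← mul_assoc, h]

/-- Two indices are kept, although at most one term is nonzero, so that the conditions on x are
strict inequalities. They persist near x, and the sum is locally over a fixed finite set, which
gives smoothness. -/
theorem periodize_eq_sum (hexp : ∀ x : ℝ≥0, 0 < x → x < φ.1 x)
    (hf : Function.support f ⊆ Ioo (a : ℝ) (φ.1 a)) {x : ℝ≥0} (hx : 0 < x) {n : ℤ}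
    (h1 : (φ ^ n).1 x < φ.1 a) (h2 : a < (φ ^ (n + 1)).1 x) :
    periodize φ lam f x = ∑ m ∈ {n, n + 1}, lam ^ (-m) * (f ((φ ^ m).1 x) : ℂ) := by
  have hmono := strictMono_zpow hexp hx
  refine finsum_eq_sum_of_support_subset _ fun m hm => ?_
  have hm' : f ((φ ^ m).1 x) ≠ 0 := by
    intro h
    exact hm (by simp only [h, Complex.ofReal_zero, mul_zero])
  obtain ⟨h3, h4⟩ := hf hm'
  rw [NNReal.coe_lt_coe] at h3 h4
  have h5 : n ≤ m := by
    by_contra! hlt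
    have h6 : (φ ^ (m + 1)).1 x ≤ (φ ^ n).1 x := hmono.monotone (by omega)
    have h7 : (φ ^ (m + 1)).1 x = φ.1 ((φ ^ m).1 x) := by rw [add_comm, zpow_one_add]; rfl
    rw [h7] at h6
    exact lt_asymm (homeo_strictMono φ.1 h3) (h6.trans_lt h1)
  have h8 : m ≤ n + 1 := by
    by_contra! hlt
    have h6 : (φ ^ (n + 1 + 1)).1 x ≤ (φ ^ m).1 x := hmono.monotone (by omega)
    have h7 : (φ ^ (n + 1 + 1)).1 x = φ.1 ((φ ^ (n + 1)).1 x) := by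
      rw [add_comm, zpow_one_add]; rfl
    rw [h7] at h6
    exact lt_asymm (homeo_strictMono φ.1 h2) (h6.trans_lt h4)
  have : m = n ∨ m = n + 1 := by omega
  simpa using this

theorem periodize_of_mem (hexp : ∀ x : ℝ≥0, 0 < x → x < φ.1 x)
    (hf : Function.support f ⊆ Ioo (a : ℝ) (φ.1 a)) {x : ℝ≥0} (ha : a < x) (hx : x < φ.1 a) :
    periodize φ lam f x = f x := by
  have hx0 : 0 < x := lt_of_le_of_lt zero_le ha
  have h1 : (φ ^ ((0 : ℤ) + 1)).1 x = φ.1 x := by simp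
  rw [periodize_eq_sum hexp hf hx0 (n := 0) (by simpa using hx)
    (by rw [h1]; exact ha.trans (hexp x hx0))]
  have h2 : f (φ.1 x) = 0 := by
    by_contra h
    have := (hf h).2
    rw [NNReal.coe_lt_coe] at this
    exact lt_asymm this (homeo_strictMono φ.1 ha)
  rw [Finset.sum_pair (by omega), h1, h2]
  simp

theorem periodize_contDiffOn (hexp : ∀ x : ℝ≥0, 0 < x → x < φ.1 x) (ha : 0 < a)
    (hfs : ContDiff ℝ ∞ f) (hf : Function.support f ⊆ Ioo (a : ℝ) (φ.1 a)) :
    ContDiffOn ℝ ∞ (fun x : ℝ => periodize φ lam f x.toNNReal) (Ioi 0) := by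
  intro x hx
  have hx0 : 0 < x.toNNReal := Real.toNNReal_pos.2 hx
  obtain ⟨n, h1, h2⟩ := exists_zpow_mem_Ico hexp ha hx0
  have h3 : a < (φ ^ (n + 1)).1 x.toNNReal :=
    h1.trans_lt (strictMono_zpow hexp hx0 (lt_add_one n))
  refine ContDiffAt.contDiffWithinAt ?_
  have hev : (fun y : ℝ => periodize φ lam f y.toNNReal) =ᶠ[𝓝 x] fun y : ℝ =>
      ∑ m ∈ {n, n + 1}, lam ^ (-m) * (f ((φ ^ m).1 y.toNNReal) : ℂ) := by
    have c : ∀ m : ℤ, Continuous fun y : ℝ => (φ ^ m).1 y.toNNReal := fun m =>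
      (φ ^ m).1.continuous.comp continuous_real_toNNReal
    filter_upwards [Ioi_mem_nhds hx, (c n).continuousAt.eventually_lt_const h2,
      (c (n + 1)).continuousAt.eventually_const_lt h3] with y hy h4 h5
    exact periodize_eq_sum hexp hf (Real.toNNReal_pos.2 hy) h4 h5
  refine ContDiffAt.congr_of_eventuallyEq ?_ hev
  refine ContDiffAt.sum fun m _ => contDiffAt_const.mul ?_
  have hm : ContDiffAt ℝ ∞ (fun y : ℝ => ((φ ^ m).1 y.toNNReal : ℝ)) x :=
    ContDiffOn.contDiffAt (φ ^ m).2.1 (Ici_mem_nhds hx)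
  exact Complex.ofRealCLM.contDiff.contDiffAt.comp x (hfs.contDiffAt.comp x hm)

/-- The solution obtained from a function supported in a fundamental domain. -/
def periodizeSol (lam : ℂ) (hexp : ∀ x : ℝ≥0, 0 < x → x < φ.1 x) (hlam : lam ≠ 0) (ha : 0 < a)
    (hfs : ContDiff ℝ ∞ f) (hf : Function.support f ⊆ Ioo (a : ℝ) (φ.1 a)) : Sol φ lam :=
  ⟨fun x => periodize φ lam f x.1,
    (periodize_contDiffOn (lam := lam) hexp ha hfs hf).congr fun x hx => by
      have hx' : 0 < x.toNNReal := Real.toNNReal_pos.2 hx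
      simp [extendZero, hx', -Real.toNNReal_pos],
    fun x => periodize_map hlam x.1⟩

end Bump

/-- Bump functions dual to N distinct points of the fundamental domain (1, φ 1) periodize to N
solutions that are independent by evaluation at these points; N is taken one larger than the
supposed dimension. -/
theorem not_finiteDimensional_sol {φ : HalfLineDiffeo} (hexp : ∀ x : ℝ≥0, 0 < x → x < φ.1 x)
    {lam : ℂ} (hlam : lam ≠ 0) : ¬ FiniteDimensional ℂ (Sol φ lam) := by
  intro hfin
  have h1 : (1 : ℝ≥0) < φ.1 1 := hexp 1 one_pos
  obtain ⟨u, hu⟩ : ∃ u : ℕ → ℝ≥0, Function.Injective u ∧ ∀ n, u n ∈ Ioo 1 (φ.1 1) := by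
    have := (Ioo_infinite h1).to_subtype
    let i := Infinite.natEmbedding (Ioo 1 (φ.1 1))
    exact ⟨fun n => (i n).1, Subtype.val_injective.comp i.injective, fun n => (i n).2⟩
  obtain ⟨huinj, hu⟩ := hu
  set N := Module.finrank ℂ (Sol φ lam) + 1 with hN
  have hbump : ∀ k : Fin N, ∃ f : ℝ → ℝ, ContDiff ℝ ∞ f ∧
      Function.support f ⊆ Ioo ((1 : ℝ≥0) : ℝ) (φ.1 1) ∧
      ∀ j : Fin N, f (u j) = if j = k then 1 else 0 := by
    intro k
    have hs : Ioo ((1 : ℝ≥0) : ℝ) (φ.1 1) \ ((fun j : Fin N => (u j : ℝ)) '' {k}ᶜ) ∈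
        𝓝 (u k : ℝ) := by
      refine inter_mem (Ioo_mem_nhds (NNReal.coe_lt_coe.2 (hu k).1)
        (NNReal.coe_lt_coe.2 (hu k).2)) ?_
      refine (Set.toFinite _).isClosed.isOpen_compl.mem_nhds ?_
      rintro ⟨j, hj, h⟩
      exact hj (Fin.ext (huinj (NNReal.coe_injective h)))
    obtain ⟨f, hf1, -, hf2, -, hf3⟩ := exists_contDiff_tsupport_subset (n := ⊤) hs
    have hsupp := (subset_tsupport f).trans hf1
    refine ⟨f, hf2, fun x hx => (hsupp hx).1, fun j => ?_⟩
    split_ifs with hjk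
    · rw [hjk, hf3]
    · by_contra h
      exact (hsupp h).2 ⟨j, hjk, rfl⟩
  choose f hfs hf hfu using hbump
  let b : Fin N → Sol φ lam := fun k => periodizeSol lam hexp hlam one_pos (hfs k) (hf k)
  have hpos : ∀ j : ℕ, 0 < u j := fun j => one_pos.trans (hu j).1
  have hb : ∀ j k : Fin N, (b k).1 ⟨u j, hpos j⟩ = if j = k then 1 else 0 := by
    intro j k
    have : (b k).1 ⟨u j, hpos j⟩ = f k (u j) :=
      periodize_of_mem (lam := lam) hexp (hf k) (hu j).1 (hu j).2
    rw [this, hfu]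
    split_ifs <;> simp
  have hli : LinearIndependent ℂ b := by
    rw [Fintype.linearIndependent_iff]
    intro c hc j
    have h2 := congrArg (fun β : Sol φ lam => β.1 ⟨u j, hpos j⟩) hc
    simpa [hb] using h2
  have := hli.fintype_card_le_finrank
  rw [Fintype.card_fin] at this
  omega

end LCReeb

end

noncomputable section

namespace LCReeb

namespace HopfData

variable (D : HopfData)

/-! ## The universal covering -/

theorem surjective_proj : Function.Surjective D.proj := Quotient.exists_rep

/-- The straight-line homotopy to (0, 1) avoids the removed point: at time t > 0 the transverse
coordinate is at least t. -/
instance : ContractibleSpace D.Cover := by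
  let base : D.Cover := ⟨(0, 1), fun h => one_ne_zero (congrArg Prod.snd h)⟩
  rw [contractible_iff_id_nullhomotopic]
  have hne : ∀ (t : unitInterval) (q : D.Cover),
      (((1 - (t : ℝ) : ℝ) : ℂ) • q.1.1, (1 - (t : ℝ)).toNNReal * q.1.2 + (t : ℝ).toNNReal) ≠
        (0 : Model) := by
    intro t q h
    have h1 := congrArg Prod.fst h
    have h2 := congrArg Prod.snd h
    simp only [Prod.fst_zero, Prod.snd_zero, add_eq_zero, Real.toNNReal_eq_zero] at h1 h2
    have ht : (t : ℝ) = 0 := le_antisymm h2.2 t.2.1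
    simp only [ht, sub_zero, Complex.ofReal_one, one_smul, Real.toNNReal_one, one_mul] at h1 h2
    exact q.2 (Prod.ext h1 h2.1)
  refine ⟨base, ⟨⟨⟨fun p => ⟨_, hne p.1 p.2⟩, ?_⟩, fun q => ?_, fun q => ?_⟩⟩⟩
  · refine Continuous.subtype_mk ?_ _
    refine Continuous.prodMk ?_ ?_
    · exact (Complex.continuous_ofReal.comp (by fun_prop)).smul (by fun_prop)
    · fun_prop
  · ext1
    simp
  · ext1
    simp [base]

/-- The half line inherits the property from ℝ as a quotient by `Real.toNNReal`. With
contractibility, this is what the lifting criterion needs. -/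
instance : LocallyPathConnectedSpace D.Cover := by
  have h1 : LocallyPathConnectedSpace ℝ≥0 :=
    (IsQuotientMap.of_inverse (f := fun x : ℝ≥0 => (x : ℝ)) (g := Real.toNNReal)
      NNReal.continuous_coe continuous_real_toNNReal fun x => Real.toNNReal_coe).locallyPathConnectedSpace
  exact isOpen_ne_zero.locallyPathConnectedSpace

/-- The deck transformations `T ^ n` of `R̃`. -/
def deck (n : ℤ) (q : D.Cover) : D.Cover := ⟨(D.T ^ n) q.1, D.T_zpow_ne_zero n q.2⟩

instance : MulAction (Multiplicative ℤ) D.Cover where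
  smul n q := D.deck n.toAdd q
  one_smul _ := rfl
  mul_smul n m q := Subtype.ext <| by
    change (D.T ^ (n.toAdd + m.toAdd)) q.1 = (D.T ^ n.toAdd) ((D.T ^ m.toAdd) q.1)
    rw [zpow_add, Homeomorph.mul_apply]

theorem isQuotientCoveringMap_proj : IsQuotientCoveringMap D.proj (Multiplicative ℤ) where
  toIsQuotientMap := isQuotientMap_quotient_mk'
  continuous_const_smul n := ((D.T ^ n.toAdd).continuous.comp continuous_subtype_val).subtype_mk _
  apply_eq_iff_mem_orbit {q r} := by
    rw [eq_comm, D.proj_eq_iff]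
    constructor
    · rintro ⟨n, hn⟩
      exact ⟨Multiplicative.ofAdd n, Subtype.ext hn⟩
    · rintro ⟨n, hn⟩
      exact ⟨n.toAdd, congrArg Subtype.val hn⟩
  disjoint q := by
    obtain ⟨U, hU, hqU, hw⟩ := D.exists_wandering q.1 q.2
    refine ⟨Subtype.val ⁻¹' U, (hU.preimage continuous_subtype_val).mem_nhds hqU, ?_⟩
    rintro n ⟨_, ⟨r, hr, rfl⟩, hs⟩
    change (D.T ^ n.toAdd) r.1 ∈ U at hs
    change n.toAdd = 0
    obtain ⟨k, hk | hk⟩ := n.toAdd.eq_nat_or_neg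
    · cases k with
      | zero => exact hk
      | succ k =>
        rw [hk, zpow_natCast] at hs
        exact absurd hs (hw k _ hr)
    · cases k with
      | zero => exact hk
      | succ k =>
        -- A negative power is excluded by applying the wandering property to the image point, which
        -- a positive power sends back to r.
        refine absurd ?_ (hw k _ hs)
        rw [← zpow_natCast, ← Homeomorph.mul_apply, ← zpow_add, hk, add_neg_cancel]
        exact hr

theorem isCoveringMap_proj : IsCoveringMap D.proj :=
  D.isQuotientCoveringMap_proj.isCoveringMap

/-- The boundary `(ℂ² ∖ {O}) × {0}` of `R̃` is connected. -/
theorem isPreconnected_boundary_cover : IsPreconnected {q : D.Cover | q.1.2 = 0} := by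
  have h1 : IsPreconnected ({0}ᶜ : Set (ℂ × ℂ)) := by
    refine (isConnected_compl_singleton_of_one_lt_rank ?_ 0).isPreconnected
    rw [← Module.finrank_eq_rank, Module.finrank_prod, Complex.finrank_real_complex]
    norm_num
  rw [isPreconnected_iff_preconnectedSpace] at h1
  have h2 : Continuous fun z : ({0}ᶜ : Set (ℂ × ℂ)) =>
      (⟨(z.1, 0), fun h => z.2 (congrArg Prod.fst h)⟩ : D.Cover) := by
    refine Continuous.subtype_mk ?_ _
    fun_prop
  convert! isPreconnected_range h2 using 1
  ext q
  constructor
  · intro hq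
    exact ⟨⟨q.1.1, fun h => q.2 (Prod.ext h hq)⟩, Subtype.ext (Prod.ext rfl hq.symm)⟩
  · rintro ⟨z, rfl⟩
    rfl

/-! ## Leafwise holomorphic maps in the universal covering -/

/-- The chart is built around a prescribed point of R̃, not merely around its class, so that a lift
can be read in charts without a deck transformation. -/
theorem exists_chart_mem_target (q : D.Cover) :
    ∃ c ∈ atlas Model D.Reeb, q.1 ∈ c.target := by
  obtain ⟨e, hqe, he⟩ := D.isLocalHomeomorph_proj q
  have hemb : IsOpenEmbedding (Subtype.val : D.Cover → Model) :=
    isOpen_ne_zero.isOpenEmbedding_subtypeVal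
  have : Nonempty D.Cover := ⟨q⟩
  have hinv : ∀ s : D.Cover, (hemb.toOpenPartialHomeomorph Subtype.val).symm s.1 = s := fun s =>
    (hemb.toOpenPartialHomeomorph Subtype.val).left_inv (by simp)
  refine ⟨e.symm ≫ₕ hemb.toOpenPartialHomeomorph _, fun r hr => ?_, ?_⟩
  · simp only [OpenPartialHomeomorph.trans_target, IsOpenEmbedding.toOpenPartialHomeomorph_target,
      mem_inter_iff, mem_range] at hr
    obtain ⟨⟨s, rfl⟩, -⟩ := hr
    exact ⟨s.2, by simp [hinv, ← he]⟩
  · simp [hinv, hqe]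

variable {D}

/-- A map of `R` induced by a leafwise holomorphic map of `R̃` is leafwise holomorphic in
charts. -/
theorem leafwisePregroupoid_property {f : D.Reeb ≃ₜ D.Reeb} {F : Model → Model}
    (hF : ∀ q : D.Cover, LeafwiseHolomorphicAt F q.1) (hFc : ContinuousOn F {0}ᶜ)
    (hfF : ∀ q : D.Cover, ∃ h : F q.1 ≠ 0, f (D.proj q) = D.proj ⟨F q.1, h⟩)
    {c c' : OpenPartialHomeomorph D.Reeb Model} (hc : c ∈ atlas Model D.Reeb)
    (hc' : c' ∈ atlas Model D.Reeb) :
    leafwisePregroupoid.property (c.symm ≫ₕ f.toOpenPartialHomeomorph ≫ₕ c')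
      (c.symm ≫ₕ f.toOpenPartialHomeomorph ≫ₕ c').source := by
  refine ⟨(c.symm ≫ₕ f.toOpenPartialHomeomorph ≫ₕ c').continuousOn, fun q hq => ?_⟩
  have hqt : q ∈ c.target := hq.1
  have hqs : f (c.symm q) ∈ c'.source := hq.2.2
  obtain ⟨h0, h1⟩ := hc q hqt
  obtain ⟨h2, h3⟩ := hfF ⟨q, h0⟩
  obtain ⟨h0', h1'⟩ := hc' _ (c'.map_source hqs)
  have h4 : D.proj ⟨F q, h2⟩ = D.proj ⟨_, h0'⟩ := by
    rw [h1', c'.left_inv hqs, ← h1, h3]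
  obtain ⟨n, hn⟩ := D.proj_eq_iff.1 h4
  have hcont : ContinuousOn (fun r => (D.T ^ n : Model ≃ₜ Model) (F r)) {0}ᶜ :=
    (D.T ^ n).continuous.comp_continuousOn hFc
  have hopen : IsOpen ({0}ᶜ : Set Model) := isOpen_compl_singleton
  -- The chart c' may pick another sheet than F does; near q the expression in charts is Tⁿ ∘ F.
  have hhol : LeafwiseHolomorphicAt ((D.T ^ n : Model ≃ₜ Model) ∘ F) q :=
    (D.leafwiseHolomorphicAt_T_zpow n _).comp (hF ⟨q, h0⟩) hopen h0 hFc
  refine hhol.congr (s := c.target ∩ ({0}ᶜ ∩ (fun r => (D.T ^ n : Model ≃ₜ Model) (F r)) ⁻¹'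
    c'.target)) (c.open_target.inter (hcont.isOpen_inter_preimage hopen c'.open_target))
    ⟨hqt, h0, ?_⟩ ?_
  · change (D.T ^ n) (F q) ∈ c'.target
    rw [hn]
    exact c'.map_source hqs
  · rintro r ⟨hr, hr0, hr'⟩
    obtain ⟨k0, k1⟩ := hc r hr
    obtain ⟨k2, k3⟩ := hfF ⟨r, k0⟩
    obtain ⟨k0', k1'⟩ := hc' _ hr'
    have : D.proj ⟨F r, k2⟩ = D.proj ⟨(D.T ^ n) (F r), k0'⟩ := D.proj_eq_iff.2 ⟨n, rfl⟩
    change c' (f (c.symm r)) = (D.T ^ n) (F r)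
    rw [← k1, k3, this, k1', c'.right_inv hr']

theorem mem_leafwiseAut_of_lift {f : D.Reeb ≃ₜ D.Reeb} {F : Model ≃ₜ Model} (hF0 : F 0 = 0)
    (hF : ∀ q : Model, LeafwiseHolomorphicAt F q) (hF' : ∀ q : Model, LeafwiseHolomorphicAt F.symm q)
    (hfF : ∀ q r : D.Cover, F q.1 = r.1 → f (D.proj q) = D.proj r) :
    f ∈ LeafwiseAut D.Reeb := by
  have hF0' : F.symm 0 = 0 := by rw [Homeomorph.symm_apply_eq, hF0]
  refine ⟨⟨f, fun c c' hc hc' => ?_⟩, rfl⟩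
  refine mem_groupoid_of_pregroupoid.2 ⟨?_, ?_⟩
  · exact leafwisePregroupoid_property (fun q => hF q.1) F.continuous.continuousOn
      (fun q => ⟨fun h => q.2 (F.injective (h.trans hF0.symm)), hfF _ _ rfl⟩) hc hc'
  · have e : (c.symm ≫ₕ f.toOpenPartialHomeomorph ≫ₕ c').symm =
        c'.symm ≫ₕ f.symm.toOpenPartialHomeomorph ≫ₕ c := by
      rw [OpenPartialHomeomorph.trans_symm_eq_symm_trans_symm,
        OpenPartialHomeomorph.trans_symm_eq_symm_trans_symm, OpenPartialHomeomorph.trans_assoc,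
        OpenPartialHomeomorph.symm_symm]
      rfl
    rw [← OpenPartialHomeomorph.symm_source, e]
    refine leafwisePregroupoid_property (f := f.symm) (fun q => hF' q.1)
      F.symm.continuous.continuousOn (fun q => ⟨fun h => q.2 (F.symm.injective (h.trans hF0'.symm)),
        ?_⟩) hc' hc
    rw [Homeomorph.symm_apply_eq]
    exact (hfF _ _ (F.apply_symm_apply q.1)).symm

/-- A lift to `R̃` of a leafwise holomorphic automorphism is leafwise holomorphic. -/
theorem leafwiseHolomorphicAt_of_mem {f : D.Reeb ≃ₜ D.Reeb} (hf : f ∈ LeafwiseAut D.Reeb)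
    {F : Model → Model} (hFc : ContinuousOn F {0}ᶜ)
    (hfF : ∀ q : D.Cover, ∃ h : F q.1 ≠ 0, f (D.proj q) = D.proj ⟨F q.1, h⟩) (q : D.Cover) :
    LeafwiseHolomorphicAt F q.1 := by
  obtain ⟨Φ, rfl⟩ := hf
  obtain ⟨h0, h1⟩ := hfF q
  obtain ⟨c, hc, hqc⟩ := D.exists_chart_mem_target q
  obtain ⟨c', hc', hqc'⟩ := D.exists_chart_mem_target ⟨F q.1, h0⟩
  have hopen : IsOpen ({0}ᶜ : Set Model) := isOpen_compl_singleton
  obtain ⟨hp, -⟩ := mem_groupoid_of_pregroupoid.1 (Φ.mem_groupoid c c' hc hc')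
  -- The targets of c and c' contain q and F q, so the expression of the automorphism in these
  -- charts is F itself near q.
  have hval : ∀ r ∈ c.target, ∀ hr : F r ∈ c'.target,
      Φ.toHomeomorph (c.symm r) = c'.symm (F r) := by
    intro r hr hr'
    obtain ⟨k0, k1⟩ := hc r hr
    obtain ⟨k2, k3⟩ := hfF ⟨r, k0⟩
    obtain ⟨k0', k1'⟩ := hc' _ hr'
    rw [← k1, k3, k1']
  have hmem : ∀ r ∈ c.target, F r ∈ c'.target →
      r ∈ (c.symm ≫ₕ Φ.toHomeomorph.toOpenPartialHomeomorph ≫ₕ c').source := by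
    intro r hr hr'
    refine ⟨hr, trivial, ?_⟩
    change Φ.toHomeomorph (c.symm r) ∈ c'.source
    rw [hval r hr hr']
    exact c'.map_target hr'
  refine (hp.2 q.1 (hmem _ hqc hqc')).congr (s := c.target ∩ ({0}ᶜ ∩ F ⁻¹' c'.target))
    (c.open_target.inter (hFc.isOpen_inter_preimage hopen c'.open_target)) ⟨hqc, q.2, hqc'⟩ ?_
  rintro r ⟨hr, -, hr'⟩
  change F r = c' (Φ.toHomeomorph (c.symm r))
  rw [hval r hr hr', c'.right_inv hr']

end HopfData

end LCReeb

end

noncomputable section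

namespace LCReeb

/-! ## Leafwise translations -/

/-- The map `(z, x) ↦ (z + c (e x), e x)` of `ℂ² × [0, ∞)`. -/
def shear (c : ℝ≥0 → ℂ × ℂ) (hc : Continuous c) (e : ℝ≥0 ≃ₜ ℝ≥0) : Model ≃ₜ Model where
  toFun q := (q.1 + c (e q.2), e q.2)
  invFun q := (q.1 - c q.2, e.symm q.2)
  left_inv q := by simp
  right_inv q := by simp
  continuous_toFun := by fun_prop
  continuous_invFun := by fun_prop

/-- Smoothness of c is required up to 0; for solutions of the functional equation this is supplied
by their flatness. -/
theorem leafwiseHolomorphicAt_translation {c : ℝ≥0 → ℂ × ℂ}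
    (hc : ContDiffOn ℝ ∞ (fun x : ℝ => c x.toNNReal) (Ici 0)) {e : ℝ≥0 → ℝ≥0}
    (he : SmoothHalfLine e) (q : Model) :
    LeafwiseHolomorphicAt (fun r => (r.1 + c r.2, e r.2)) q := by
  have hmaps : MapsTo Prod.snd (range Model.toReal) (Ici (0 : ℝ)) := by
    rintro _ ⟨r, rfl⟩
    exact r.2.2
  refine ⟨?_, univ, isOpen_univ, mem_univ _, ⟨e, fun _ _ => rfl⟩, fun x =>
    (differentiable_id.add_const (c x)).differentiableOn⟩
  refine ContDiffWithinAt.prodMk (contDiff_fst.contDiffWithinAt.add ?_) ?_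
  · have h : ContDiffWithinAt ℝ ∞ (fun x : ℝ => c x.toNNReal) (Ici 0) (Model.toReal q).2 :=
      hc _ q.2.2
    exact h.comp (Model.toReal q) contDiff_snd.contDiffWithinAt hmaps
  · have h : ContDiffWithinAt ℝ ∞ (fun x : ℝ => (e x.toNNReal : ℝ)) (Ici 0) (Model.toReal q).2 :=
      he _ q.2.2
    exact h.comp (Model.toReal q) contDiff_snd.contDiffWithinAt hmaps

theorem extendZero_onPos {β : PosLine → ℂ} (e : ℝ≥0 ≃ₜ ℝ≥0) (x : ℝ≥0) :
    extendZero (fun y => β (onPos e y)) x = extendZero β (e x) := by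
  rcases eq_or_ne x 0 with rfl | hx
  · simp [extendZero, homeo_map_zero]
  · have hx' := pos_iff_ne_zero.2 hx
    simp [extendZero, hx', homeo_pos e hx', onPos]

theorem extendZero_eq_of_sol {φ : HalfLineDiffeo} {lam : ℂ} (β : Sol φ lam) (x : ℝ≥0) :
    extendZero β.1 (φ.1 x) = lam * extendZero β.1 x := by
  rw [← extendZero_onPos]
  rcases eq_or_ne x 0 with rfl | hx
  · simp [extendZero]
  · have hx' := pos_iff_ne_zero.2 hx
    simp [extendZero, hx', β.2.2]

/-! ### Descent of leafwise translations to R -/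

namespace HopfData

variable (D : HopfData)

theorem T_apply (hτ : D.tau = 0) (hlm : D.lam = D.mu) (q : Model) :
    D.T q = (D.lam • q.1, D.φ.1 q.2) := by
  refine Prod.ext (Prod.ext ?_ ?_) rfl
  · simp [T, G, hτ]
  · simp [T, G, hlm]

theorem one_lt_norm_lam : 1 < ‖D.lam‖ := D.one_lt_norm_mu.trans_le D.norm_mu_le

/-- A homeomorphism of `ℂ² × [0, ∞)` commuting with `T` and fixing `(O, 0)` descends to `R`. -/
theorem exists_descent {F : Model ≃ₜ Model} (hF0 : F 0 = 0) (hT : Commute F D.T) :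
    ∃ f : D.Reeb ≃ₜ D.Reeb, ∀ q r : D.Cover, F q.1 = r.1 → f (D.proj q) = D.proj r := by
  have main : ∀ F : Model ≃ₜ Model, F 0 = 0 → Commute F D.T → ∃ f : D.Reeb → D.Reeb,
      Continuous f ∧ ∀ q r : D.Cover, F q.1 = r.1 → f (D.proj q) = D.proj r := by
    intro F hF0 hT
    have hne : ∀ q : D.Cover, F q.1 ≠ 0 := fun q h => q.2 (F.injective (h.trans hF0.symm))
    have hresp : ∀ q r : D.Cover, D.orbitSetoid.r q r →
        D.proj ⟨F q.1, hne q⟩ = D.proj ⟨F r.1, hne r⟩ := by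
      rintro q r ⟨n, hn⟩
      refine D.proj_eq_iff.2 ⟨n, ?_⟩
      have := congrArg (fun g : Model ≃ₜ Model => g q.1) (hT.zpow_right n).eq
      simp only [Homeomorph.mul_apply] at this
      rw [← this, hn]
    refine ⟨Quotient.lift (s := D.orbitSetoid) (fun q => D.proj ⟨F q.1, hne q⟩) hresp, ?_, ?_⟩
    · refine Continuous.quotient_lift (s := D.orbitSetoid) ?_ hresp
      exact D.continuous_proj.comp ((F.continuous.comp continuous_subtype_val).subtype_mk _)
    · intro q r h
      change D.proj ⟨F q.1, hne q⟩ = D.proj r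
      congr 1
      exact Subtype.ext h
  obtain ⟨f, hfc, hf⟩ := main F hF0 hT
  have hF0' : F⁻¹ 0 = 0 := (F.symm_apply_eq).2 hF0.symm
  obtain ⟨g, hgc, hg⟩ := main F⁻¹ hF0' hT.inv_left
  have hne : ∀ q : D.Cover, F q.1 ≠ 0 := fun q h => q.2 (F.injective (h.trans hF0.symm))
  have hne' : ∀ q : D.Cover, F⁻¹ q.1 ≠ 0 := fun q h => q.2 (F⁻¹.injective (h.trans hF0'.symm))
  refine ⟨⟨⟨f, g, fun P => ?_, fun P => ?_⟩, hfc, hgc⟩, hf⟩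
  · obtain ⟨q, rfl⟩ := D.surjective_proj P
    rw [hf q ⟨_, hne q⟩ rfl]
    exact hg _ _ (F.symm_apply_apply _)
  · obtain ⟨q, rfl⟩ := D.surjective_proj P
    rw [hg q ⟨_, hne' q⟩ rfl]
    exact hf _ _ (F.apply_symm_apply _)

section Translations

variable {D} (hφ : InfinitelyTangentToId D.φ)

include hφ in
theorem contDiff_translation (β : Sol D.φ D.lam × Sol D.φ D.lam) :
    ContDiff ℝ ∞ fun x : ℝ => (extendZero β.1.1 x.toNNReal, extendZero β.2.1 x.toNNReal) :=
  (contDiff_extendZero hφ D.expanding D.one_lt_norm_lam β.1).prodMk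
    (contDiff_extendZero hφ D.expanding D.one_lt_norm_lam β.2)

include hφ in
theorem continuous_translation (β : Sol D.φ D.lam × Sol D.φ D.lam) :
    Continuous fun x : ℝ≥0 => (extendZero β.1.1 x, extendZero β.2.1 x) := by
  have := (contDiff_translation hφ β).continuous.comp NNReal.continuous_coe
  simpa [Function.comp_def] using this

/-- The map `(z₁, z₂, x) ↦ (z₁ + β₁ (η x), z₂ + β₂ (η x), η x)`. -/
def coverAut (s : SemidirectProduct (Multiplicative (Sol D.φ D.lam × Sol D.φ D.lam))
    (Centr D.φ) (precompAction D.φ D.lam)) : Model ≃ₜ Model :=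
  shear (fun x => (extendZero s.left.toAdd.1.1 x, extendZero s.left.toAdd.2.1 x))
    (continuous_translation hφ s.left.toAdd) s.right.1.1

variable (s t : SemidirectProduct (Multiplicative (Sol D.φ D.lam × Sol D.φ D.lam))
    (Centr D.φ) (precompAction D.φ D.lam))

theorem coverAut_apply (q : Model) : coverAut hφ s q =
    ((q.1.1 + extendZero s.left.toAdd.1.1 (s.right.1.1 q.2),
      q.1.2 + extendZero s.left.toAdd.2.1 (s.right.1.1 q.2)), s.right.1.1 q.2) := rfl

theorem coverAut_boundary {q : Model} (hq : q.2 = 0) : coverAut hφ s q = q := by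
  obtain ⟨⟨z1, z2⟩, x⟩ := q
  obtain rfl : x = 0 := hq
  simp [coverAut_apply, homeo_map_zero, extendZero]

theorem coverAut_mul (q : Model) :
    coverAut hφ (s * t) q = coverAut hφ s (coverAut hφ t q) := by
  have h : ∀ β γ : Sol D.φ D.lam, extendZero (β + precomp s.right⁻¹ γ).1
      (s.right.1.1 (t.right.1.1 q.2)) =
      extendZero β.1 (s.right.1.1 (t.right.1.1 q.2)) + extendZero γ.1 (t.right.1.1 q.2) := by
    intro β γ
    -- The inverse in the action cancels the outer transverse map: the second translation is
    -- evaluated at the point reached after applying t alone.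
    have h1 : extendZero (precomp s.right⁻¹ γ).1 (s.right.1.1 (t.right.1.1 q.2)) =
        extendZero γ.1 (t.right.1.1 q.2) := by
      refine (extendZero_onPos s.right⁻¹.1.1 _).trans ?_
      congr 1
      exact s.right.1.1.symm_apply_apply _
    rw [← h1]
    by_cases hx : 0 < s.right.1.1 (t.right.1.1 q.2)
    · simp [extendZero, hx]
    · simp [extendZero, hx]
  have e1 := h s.left.toAdd.1 t.left.toAdd.1
  have e2 := h s.left.toAdd.2 t.left.toAdd.2
  refine Prod.ext (Prod.ext ?_ ?_) rfl
  · refine (congrArg (q.1.1 + ·) e1).trans ?_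
    simp only [coverAut_apply]
    ring
  · refine (congrArg (q.1.2 + ·) e2).trans ?_
    simp only [coverAut_apply]
    ring

theorem commute_coverAut (hτ : D.tau = 0) (hlm : D.lam = D.mu) :
    Commute (coverAut hφ s) D.T := by
  refine Homeomorph.ext fun q => ?_
  have hη : s.right.1.1 (D.φ.1 q.2) = D.φ.1 (s.right.1.1 q.2) := by
    have h : D.φ * s.right.1 = s.right.1 * D.φ := Subgroup.mem_centralizer_iff.1 s.right.2 _ rfl
    exact (congrArg (fun f : HalfLineDiffeo => f.1 q.2) h).symm
  rw [Homeomorph.mul_apply, Homeomorph.mul_apply, D.T_apply hτ hlm, D.T_apply hτ hlm]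
  simp only [coverAut_apply, hη, extendZero_eq_of_sol]
  simp [mul_add]

theorem exists_autRelBoundary (hτ : D.tau = 0) (hlm : D.lam = D.mu) :
    ∃ f : D.AutRelBoundary, ∀ q r : D.Cover, coverAut hφ s q.1 = r.1 →
      f.1 (D.proj q) = D.proj r := by
  have h0 : coverAut hφ s 0 = 0 := coverAut_boundary hφ s rfl
  obtain ⟨f, hf⟩ := D.exists_descent h0 (commute_coverAut hφ s hτ hlm)
  have hc := (contDiff_translation hφ s.left.toAdd).contDiffOn (s := Ici 0)
  refine ⟨⟨f, mem_leafwiseAut_of_lift h0 (fun q => ?_) (fun q => ?_) hf, ?_⟩, hf⟩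
  · have hη : ContDiffOn ℝ ∞ (fun x : ℝ => (s.right.1.1 x.toNNReal : ℝ)) (Ici 0) := s.right.1.2.1
    refine leafwiseHolomorphicAt_translation (c := fun x =>
      (extendZero s.left.toAdd.1.1 (s.right.1.1 x), extendZero s.left.toAdd.2.1 (s.right.1.1 x)))
      ?_ s.right.1.2.1 q
    refine (hc.comp hη fun x _ => NNReal.coe_nonneg _).congr fun x _ => ?_
    simp
  · have := leafwiseHolomorphicAt_translation (c := fun x =>
      -(extendZero s.left.toAdd.1.1 x, extendZero s.left.toAdd.2.1 x)) hc.neg s.right.1.2.2 q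
    simp only [← sub_eq_add_neg] at this
    exact this
  · rintro _ ⟨q, hq, rfl⟩
    exact hf q q (coverAut_boundary hφ s hq)

/-- Such a map is a lift of `proj` through itself that fixes a boundary point, hence the identity by
uniqueness of lifts; its components are then read off at the points ((1, 0), x). -/
theorem coverAut_eq_one_of_proj (hs : ∀ q r : D.Cover, coverAut hφ s q.1 = r.1 →
    D.proj q = D.proj r) : s = 1 := by
  have h0 : coverAut hφ s 0 = 0 := coverAut_boundary hφ s rfl
  have hne : ∀ q : D.Cover, coverAut hφ s q.1 ≠ 0 := fun q h =>
    q.2 ((coverAut hφ s).injective (h.trans h0.symm))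
  let q₀ : D.Cover := ⟨((1, 0), 0), fun h => one_ne_zero (congrArg (fun q : Model => q.1.1) h)⟩
  have hid : (fun q : D.Cover => (⟨coverAut hφ s q.1, hne q⟩ : D.Cover)) = id := by
    refine D.isCoveringMap_proj.eq_of_comp_eq
      (((coverAut hφ s).continuous.comp continuous_subtype_val).subtype_mk _) continuous_id
      (funext fun q => (hs q _ rfl).symm) q₀ (Subtype.ext (coverAut_boundary hφ s rfl))
  have hfix : ∀ q : Model, q ≠ 0 → coverAut hφ s q = q := fun q hq =>
    congrArg Subtype.val (congrFun hid ⟨q, hq⟩)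
  have hpt : ∀ x : ℝ≥0, (((1, 0), x) : Model) ≠ 0 := fun x h =>
    one_ne_zero (congrArg (fun q : Model => q.1.1) h)
  have hη : ∀ x, s.right.1.1 x = x := fun x => congrArg Prod.snd (hfix _ (hpt x))
  have hβ1 : ∀ x, extendZero s.left.toAdd.1.1 x = 0 := fun x => by
    have := congrArg (fun q : Model => q.1.1) (hfix _ (hpt x))
    simpa [coverAut_apply, hη] using this
  have hβ2 : ∀ x, extendZero s.left.toAdd.2.1 x = 0 := fun x => by
    have := congrArg (fun q : Model => q.1.2) (hfix _ (hpt x))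
    simpa [coverAut_apply, hη] using this
  have hz : ∀ β : Sol D.φ D.lam, (∀ x, extendZero β.1 x = 0) → β = 0 := fun β h =>
    Subtype.ext <| funext fun x => by
      have h1 := h x.1
      have h2 : (0 : ℝ≥0) < x.1 := x.2
      simpa [extendZero, h2] using h1
  refine SemidirectProduct.ext ?_ ?_
  · exact congrArg Multiplicative.ofAdd (Prod.ext (hz _ hβ1) (hz _ hβ2))
  · exact Subtype.ext (Subtype.ext (Homeomorph.ext hη))

end Translations

end HopfData

end LCReeb

end

noncomputable section

namespace LCReeb

open Filter

/-- A strengthening of Liouville's theorem: an entire function that grows slower than linearly is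
constant. -/
theorem eq_of_norm_le_mul_norm {E F : Type*} [NormedAddCommGroup E] [NormedSpace ℂ E]
    [NormedAddCommGroup F] [NormedSpace ℂ F] {g : E → F} (hg : Differentiable ℂ g)
    (h : ∀ ε > 0, ∃ C : ℝ, ∀ z, C ≤ ‖z‖ → ‖g z‖ ≤ ε * ‖z‖) (z : E) : g z = g 0 := by
  rcases eq_or_ne z 0 with rfl | hz
  · rfl
  have hz0 : 0 < ‖z‖ := norm_pos_iff.2 hz
  have hk : Differentiable ℂ fun t : ℂ => g (t • z) :=
    hg.comp (differentiable_id.smul_const z)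
  have hderiv : ∀ t₀, deriv (fun t : ℂ => g (t • z)) t₀ = 0 := by
    intro t₀
    rw [← norm_le_zero_iff]
    refine le_of_forall_pos_le_add fun δ hδ => ?_
    rw [zero_add]
    obtain ⟨C, hC⟩ := h (δ / (2 * ‖z‖)) (by positivity)
    -- On the circle of radius R about t₀ one has ‖t • z‖ ≥ C and ‖t‖ ≤ 2R, so Cauchy's estimate
    -- bounds the derivative by δ.
    set R : ℝ := |C| / ‖z‖ + ‖t₀‖ + 1 with hR
    have hR0 : 0 < R := by positivity
    have hbound : ∀ t ∈ Metric.sphere t₀ R, ‖g (t • z)‖ ≤ δ * R := by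
      intro t ht
      have ht' : ‖t - t₀‖ = R := by rwa [mem_sphere_iff_norm] at ht
      have h1 : R - ‖t₀‖ ≤ ‖t‖ := by
        have := norm_sub_le t t₀
        linarith
      have h2 : ‖t‖ ≤ 2 * R := by
        have := norm_add_le (t - t₀) t₀
        rw [sub_add_cancel] at this
        have : ‖t₀‖ ≤ R := by
          have : 0 ≤ |C| / ‖z‖ := by positivity
          linarith
        linarith
      have h3 : C ≤ ‖t • z‖ := by
        rw [norm_smul]
        have h4 : |C| / ‖z‖ ≤ ‖t‖ := by linarith
        rw [div_le_iff₀ hz0] at h4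
        exact (le_abs_self C).trans h4
      refine (hC _ h3).trans ?_
      rw [norm_smul]
      calc δ / (2 * ‖z‖) * (‖t‖ * ‖z‖) = δ / 2 * ‖t‖ := by field_simp
        _ ≤ δ / 2 * (2 * R) := by gcongr
        _ = δ * R := by ring
    have := Complex.norm_deriv_le_of_forall_mem_sphere_norm_le hR0 hk.diffContOnCl hbound
    rwa [mul_div_assoc, div_self hR0.ne', mul_one] at this
  have := is_const_of_deriv_eq_zero hk hderiv 1 0
  simpa using this

/-! ### Lifts of automorphisms to the covering -/

namespace HopfData

variable {D : HopfData}

/-- The base point of the covering, in the boundary. -/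
def basePoint (D : HopfData) : D.Cover :=
  ⟨((1, 0), 0), fun h => one_ne_zero (congrArg (fun q : Model => q.1.1) h)⟩

/-- The lift to `R̃` of an automorphism that is the identity on the boundary. -/
structure IsBoundaryLift (f : D.Reeb ≃ₜ D.Reeb) (F : D.Cover → D.Cover) : Prop where
  continuous : Continuous F
  proj_apply : ∀ q, D.proj (F q) = f (D.proj q)
  boundary : ∀ q, q.1.2 = 0 → F q = q

/-- The lift is normalized at one boundary point. On the connected boundary of R̃ it and the
identity lift the same map, so they agree there. -/
theorem exists_isBoundaryLift {f : D.Reeb ≃ₜ D.Reeb} (hf : ∀ P ∈ D.boundary, f P = P) :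
    ∃ F, IsBoundaryLift f F := by
  have hq₀ : D.basePoint.1.2 = 0 := rfl
  obtain ⟨F, ⟨hF0, hF⟩, -⟩ := D.isCoveringMap_proj.existsUnique_continuousMap_lifts
    ⟨_, f.continuous.comp D.continuous_proj⟩ D.basePoint D.basePoint
    (hf _ ⟨D.basePoint, hq₀, rfl⟩).symm
  refine ⟨F, F.continuous, fun q => congrFun hF q, fun q hq => ?_⟩
  refine D.isCoveringMap_proj.eqOn_of_comp_eqOn D.isPreconnected_boundary_cover
    F.continuous.continuousOn continuousOn_id (fun r hr => ?_) hq₀ hF0 hq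
  exact (congrFun hF r).trans (hf _ ⟨r, hr, rfl⟩)

namespace IsBoundaryLift

variable {f g : D.Reeb ≃ₜ D.Reeb} {F G : D.Cover → D.Cover}

theorem comp_apply_of_mul_eq_one (hF : IsBoundaryLift f F) (hG : IsBoundaryLift g G)
    (hfg : f * g = 1) (q : D.Cover) : F (G q) = q := by
  have : F ∘ G = id := by
    refine D.isCoveringMap_proj.eq_of_comp_eq (hF.continuous.comp hG.continuous) continuous_id
      (funext fun q => ?_) D.basePoint ?_
    · change D.proj (F (G q)) = D.proj q
      rw [hF.proj_apply, hG.proj_apply]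
      exact congrArg (fun h : D.Reeb ≃ₜ D.Reeb => h (D.proj q)) hfg
    · change F (G D.basePoint) = D.basePoint
      rw [hG.boundary _ rfl, hF.boundary _ rfl]
  exact congrFun this q

/-- Both sides lift f ∘ `proj`, and they agree at the base point because its deck translates stay in
the boundary, where F is the identity. -/
theorem apply_deck (hF : IsBoundaryLift f F) (n : ℤ) (q : D.Cover) :
    F (D.deck n q) = D.deck n (F q) := by
  have hc : Continuous (D.deck n) :=
    ((D.T ^ n).continuous.comp continuous_subtype_val).subtype_mk _
  have hp : ∀ q, D.proj (D.deck n q) = D.proj q := fun q =>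
    (D.proj_eq_iff.2 ⟨n, rfl⟩).symm
  have hb : (D.deck n D.basePoint).1.2 = 0 := by
    have : ∀ m : ℕ, ∀ r : Model, ((D.T ^ m) r).2 = 0 ↔ r.2 = 0 := by
      intro m
      induction m with
      | zero => exact fun _ => Iff.rfl
      | succ m ih =>
        intro r
        rw [T_pow_succ, ← ih r]
        change D.φ.1 _ = 0 ↔ _
        rw [← (homeo_map_zero D.φ.1), D.φ.1.injective.eq_iff, homeo_map_zero]
        rfl
    change ((D.T ^ n) D.basePoint.1).2 = 0
    obtain ⟨k, rfl | rfl⟩ := n.eq_nat_or_neg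
    · rw [zpow_natCast, this]
      rfl
    · rw [← this k, ← zpow_natCast, ← Homeomorph.mul_apply, ← zpow_add, add_neg_cancel]
      rfl
  have : F ∘ D.deck n = D.deck n ∘ F := by
    refine D.isCoveringMap_proj.eq_of_comp_eq (hF.continuous.comp hc) (hc.comp hF.continuous)
      (funext fun q => ?_) D.basePoint ?_
    · change D.proj (F (D.deck n q)) = D.proj (D.deck n (F q))
      rw [hF.proj_apply, hp, hp, hF.proj_apply]
    · change F (D.deck n D.basePoint) = D.deck n (F D.basePoint)
      rw [hF.boundary _ hb, hF.boundary _ rfl]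
  exact congrFun this q

end IsBoundaryLift

/-- Extension of a self-map of `R̃` to `ℂ² × [0, ∞)`. -/
def extendCover (F : D.Cover → D.Cover) (q : Model) : Model := if h : q ≠ 0 then (F ⟨q, h⟩).1 else 0

theorem extendCover_apply (F : D.Cover → D.Cover) (q : D.Cover) : extendCover F q.1 = (F q).1 :=
  dif_pos q.2

theorem continuousOn_extendCover {F : D.Cover → D.Cover} (hF : Continuous F) :
    ContinuousOn (extendCover F) {0}ᶜ := by
  rw [continuousOn_iff_continuous_domRestrict]
  refine (continuous_subtype_val.comp hF).congr fun q => ?_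
  exact (extendCover_apply F q).symm

/-! ## The form of the lift -/

/-- The properties of the lift of an element of `Aut(R, H)`, extended to `ℂ² × [0, ∞)`, on which
its form depends. -/
structure IsEquivariantLift (D : HopfData) (F : Model → Model) : Prop where
  continuousOn : ContinuousOn F {0}ᶜ
  holomorphic : ∀ q, q ≠ 0 → LeafwiseHolomorphicAt F q
  boundary : ∀ q : Model, q.2 = 0 → F q = q
  equivariant : ∀ (n : ℤ) (q : Model), q ≠ 0 → F ((D.T ^ n) q) = (D.T ^ n) (F q)

theorem IsBoundaryLift.isEquivariantLift {f : D.Reeb ≃ₜ D.Reeb} {F : D.Cover → D.Cover}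
    (hF : IsBoundaryLift f F) (hf : f ∈ LeafwiseAut D.Reeb) :
    IsEquivariantLift D (extendCover F) where
  continuousOn := continuousOn_extendCover hF.continuous
  holomorphic q hq := by
    refine leafwiseHolomorphicAt_of_mem hf (continuousOn_extendCover hF.continuous)
      (fun r => ?_) ⟨q, hq⟩
    simp only [extendCover_apply, Subtype.coe_eta, exists_prop, hF.proj_apply, and_true]
    exact (F r).2
  boundary q hq := by
    by_cases h : q = 0
    · simp [extendCover, h]
    · rw [extendCover_apply F ⟨q, h⟩, hF.boundary _ hq]
  equivariant n q hq := by
    have := hF.apply_deck n ⟨q, hq⟩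
    rw [extendCover_apply F ⟨q, hq⟩]
    exact (extendCover_apply F (D.deck n ⟨q, hq⟩)).trans (congrArg Subtype.val this)

theorem T_pow_apply (hτ : D.tau = 0) (hlm : D.lam = D.mu) (n : ℕ) (q : Model) :
    (D.T ^ n) q = (D.lam ^ n • q.1, (D.φ ^ n).1 q.2) := by
  induction n with
  | zero => simp
  | succ n ih =>
    rw [T_pow_succ, ih, D.T_apply hτ hlm, pow_succ', pow_succ', mul_smul]
    rfl

namespace IsEquivariantLift

variable {F : Model → Model} (hF : IsEquivariantLift D F)

theorem base_ne_zero (x : ℝ≥0) : (((1, 0), x) : Model) ≠ 0 := fun h =>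
  one_ne_zero (congrArg (fun q : Model => q.1.1) h)

/-- The transverse component of the lift. -/
def transverse (F : Model → Model) (x : ℝ≥0) : ℝ≥0 := (F ((1, 0), x)).2

/-- The translation component of the lift. -/
def translation (F : Model → Model) (x : ℝ≥0) : ℂ × ℂ := (F ((1, 0), x)).1 - (1, 0)

include hF

/-- In foliated charts the transverse component is locally constant along a leaf, and the leaf ℂ² ×
{x} is connected. -/
theorem snd_apply (q : Model) : (F q).2 = transverse F q.2 := by
  obtain ⟨z, x⟩ := q
  rcases eq_or_ne x 0 with rfl | hx
  · rw [hF.boundary _ rfl, transverse, hF.boundary _ rfl]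
  have hne : ∀ w : ℂ × ℂ, ((w, x) : Model) ≠ 0 := fun w h => hx (congrArg Prod.snd h)
  have hloc : IsLocallyConstant fun w : ℂ × ℂ => (F (w, x)).2 := by
    rw [IsLocallyConstant.iff_eventually_eq]
    intro w
    obtain ⟨-, u, hu, hwu, ⟨k, hk⟩, -⟩ := hF.holomorphic _ (hne w)
    have hc : Continuous fun w' : ℂ × ℂ => ((w', x) : Model) := by fun_prop
    filter_upwards [(hu.preimage hc).mem_nhds hwu] with w' hw'
    rw [hk _ hw', hk _ hwu]
  exact hloc.apply_eq_of_isPreconnected isPreconnected_univ (mem_univ _) (mem_univ _)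

theorem differentiable_slice {x : ℝ≥0} (hx : x ≠ 0) :
    Differentiable ℂ fun z : ℂ × ℂ => (F (z, x)).1 := by
  intro z
  have hne : ((z, x) : Model) ≠ 0 := fun h => hx (congrArg Prod.snd h)
  obtain ⟨-, u, hu, hzu, -, hd⟩ := hF.holomorphic _ hne
  have hc : Continuous fun w : ℂ × ℂ => ((w, x) : Model) := by fun_prop
  exact (hd x).differentiableAt ((hu.preimage hc).mem_nhds hzu)

/-- Boundary behaviour controls the growth on interior leaves: Tⁿ carries a neighbourhood of the
compact shell 1 ≤ ‖w‖ ≤ |λ| at x = 0 to infinity in the leaf, scaling F - id by exactly |λ|ⁿ. This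
uses that T acts on ℂ² by a scalar. -/
theorem exists_norm_sub_le (hτ : D.tau = 0) (hlm : D.lam = D.mu) {x : ℝ≥0} (hx : x ≠ 0)
    {ε : ℝ} (hε : 0 < ε) : ∃ C : ℝ, ∀ z : ℂ × ℂ, C ≤ ‖z‖ → ‖(F (z, x)).1 - z‖ ≤ ε * ‖z‖ := by
  have hlam := D.one_lt_norm_lam
  have hx0 : 0 < x := pos_iff_ne_zero.2 hx
  set K : Set (ℂ × ℂ) := Metric.closedBall 0 ‖D.lam‖ ∩ {z | 1 ≤ ‖z‖} with hK
  have hKc : IsCompact K := (isCompact_closedBall 0 ‖D.lam‖).inter_right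
    (isClosed_le continuous_const continuous_norm)
  have hopen : IsOpen ({0}ᶜ : Set Model) := isOpen_compl_singleton
  have hcont : ContinuousOn (fun q : Model => ‖(F q).1 - q.1‖) {0}ᶜ :=
    (hF.continuousOn.fst.sub continuous_fst.continuousOn).norm
  have hN := hcont.isOpen_inter_preimage hopen (isOpen_Iio (a := ε))
  -- F is the identity on K × {0}, so compactness of K gives one interval [0, δ) over which F is
  -- ε-close to the identity on all of K.
  obtain ⟨u, v, -, hv, hKu, h0v, huv⟩ := generalized_tube_lemma hKc
    (isCompact_singleton (x := (0 : ℝ≥0))) hN (by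
      rintro ⟨z, y⟩ ⟨hz, hy⟩
      obtain rfl : y = 0 := hy
      refine ⟨fun h => ?_, ?_⟩
      · have h1 : z = 0 := congrArg Prod.fst h
        have h2 : 1 ≤ ‖z‖ := hz.2
        rw [h1, norm_zero] at h2
        linarith
      · simp [hF.boundary (z, 0) rfl, hε])
  obtain ⟨δ, hδ0, hδ⟩ := exists_Ico_subset_of_mem_nhds (hv.mem_nhds (h0v rfl)) ⟨1, one_pos⟩
  obtain ⟨a, ha0, haδ⟩ := exists_between hδ0
  obtain ⟨k, hk⟩ := exists_le_pow D.expanding ha0 x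
  -- If ‖z‖ ≥ |λ|ᵏ, the n that brings z into the shell is at least k, and then φ⁻ⁿ x ≤ a < δ.
  refine ⟨‖D.lam‖ ^ k, fun z hz => ?_⟩
  obtain ⟨n, hn1, hn2⟩ := exists_nat_pow_near ((one_le_pow₀ hlam.le).trans hz) hlam
  have hkn : k ≤ n := by
    have := (pow_lt_pow_iff_right₀ hlam).1 (hz.trans_lt hn2)
    omega
  have hlamn : 0 < ‖D.lam‖ ^ n := by positivity
  set y : ℝ≥0 := (D.φ ^ n).1.symm x with hy
  have hya : y ≤ a := by
    have h1 : x ≤ (D.φ ^ n).1 a := by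
      refine hk.trans ?_
      have := (strictMono_zpow D.expanding ha0).monotone (Int.ofNat_le.2 hkn)
      simpa only [Int.ofNat_eq_natCast, zpow_natCast] using this
    have h2 := (homeo_strictMono (D.φ ^ n).1.symm).monotone h1
    rwa [Homeomorph.symm_apply_apply] at h2
  set w : ℂ × ℂ := (D.lam ^ n)⁻¹ • z with hw
  have hlam0 : D.lam ^ n ≠ 0 := pow_ne_zero _ D.lam_ne_zero
  have hwn : ‖w‖ = ‖z‖ / ‖D.lam‖ ^ n := by
    rw [hw, norm_smul, norm_inv, norm_pow, inv_mul_eq_div]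
  have hwK : w ∈ K := by
    constructor
    · rw [mem_closedBall_zero_iff, hwn, div_le_iff₀ hlamn, ← pow_succ']
      exact hn2.le
    · change 1 ≤ ‖w‖
      rw [hwn, le_div_iff₀ hlamn, one_mul]
      exact hn1
  have hT : (D.T ^ n) (w, y) = (z, x) := by
    rw [T_pow_apply hτ hlm, hw, hy, smul_inv_smul₀ hlam0, Homeomorph.apply_symm_apply]
  have hmem := huv (mk_mem_prod (hKu hwK) (hδ ⟨zero_le, hya.trans_lt haδ⟩))
  have hFz : (F (z, x)).1 = D.lam ^ n • (F (w, y)).1 := by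
    have := hF.equivariant n (w, y) hmem.1
    rw [zpow_natCast, hT, T_pow_apply hτ hlm] at this
    rw [this]
  have hz' : z = D.lam ^ n • w := by rw [hw, smul_inv_smul₀ hlam0]
  have hlt : ‖(F (w, y)).1 - w‖ < ε := hmem.2
  calc ‖(F (z, x)).1 - z‖ = ‖D.lam‖ ^ n * ‖(F (w, y)).1 - w‖ := by
        rw [hFz]
        conv_lhs => rw [hz']
        rw [← smul_sub, norm_smul, norm_pow]
    _ ≤ ‖D.lam‖ ^ n * ε := by gcongr
    _ ≤ ‖z‖ * ε := by gcongr
    _ = ε * ‖z‖ := mul_comm _ _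

/-- For x ≠ 0 the difference F(z, x) - z is entire in z and o(‖z‖), hence constant; its value is
read at (1, 0). -/
theorem fst_apply (hτ : D.tau = 0) (hlm : D.lam = D.mu) (q : Model) :
    (F q).1 = q.1 + translation F q.2 := by
  obtain ⟨z, x⟩ := q
  rcases eq_or_ne x 0 with rfl | hx
  · rw [translation, hF.boundary _ rfl, hF.boundary _ rfl]
    simp
  have hd : Differentiable ℂ fun z : ℂ × ℂ => (F (z, x)).1 - z :=
    (hF.differentiable_slice hx).sub differentiable_id
  have h := eq_of_norm_le_mul_norm hd fun ε hε => hF.exists_norm_sub_le hτ hlm hx hε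
  change (F (z, x)).1 = z + ((F ((1, 0), x)).1 - (1, 0))
  rw [(h (1, 0)).trans (h z).symm]
  abel

theorem translation_zero : translation F 0 = 0 := by
  rw [translation, hF.boundary _ rfl]
  simp

theorem continuous_transverse : Continuous (transverse F) := by
  have hc : Continuous fun x : ℝ≥0 => (((1, 0), x) : Model) := by fun_prop
  exact continuous_snd.comp (hF.continuousOn.comp_continuous hc base_ne_zero)

theorem contDiffOn_base :
    ContDiffOn ℝ ∞ (fun x : ℝ => Model.toReal (F ((1, 0), x.toNNReal))) (Ici 0) := by
  intro x hx
  obtain ⟨h, -⟩ := hF.holomorphic _ (base_ne_zero x.toNNReal)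
  have hx' : Model.toReal ((1, 0), x.toNNReal) = ((1, 0), x) := by
    simp [Model.toReal, Real.coe_toNNReal x hx]
  rw [hx'] at h
  have hi : ContDiffWithinAt ℝ ∞ (fun y : ℝ => (((1, 0), y) : (ℂ × ℂ) × ℝ)) (Ici 0) x :=
    (contDiff_const.prodMk contDiff_id).contDiffWithinAt
  refine h.comp x hi fun y hy => ⟨((1, 0), y.toNNReal), ?_⟩
  simp [Model.toReal, Real.coe_toNNReal y hy]

theorem smoothHalfLine_transverse : SmoothHalfLine (transverse F) := hF.contDiffOn_base.snd

theorem contDiffOn_translation :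
    ContDiffOn ℝ ∞ (fun x : ℝ => translation F x.toNNReal) (Ici 0) :=
  hF.contDiffOn_base.fst.sub contDiffOn_const

theorem transverse_map (x : ℝ≥0) : transverse F (D.φ.1 x) = D.φ.1 (transverse F x) := by
  have h := congrArg Prod.snd (hF.equivariant 1 _ (base_ne_zero x))
  rw [zpow_one, hF.snd_apply] at h
  exact h

theorem translation_map (hτ : D.tau = 0) (hlm : D.lam = D.mu) (x : ℝ≥0) :
    translation F (D.φ.1 x) = D.lam • translation F x := by
  have h := congrArg Prod.fst (hF.equivariant 1 _ (base_ne_zero x))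
  rw [zpow_one, hF.fst_apply hτ hlm, D.T_apply hτ hlm, D.T_apply hτ hlm,
    hF.fst_apply hτ hlm] at h
  simpa using h

theorem apply_eq (hτ : D.tau = 0) (hlm : D.lam = D.mu) (q : Model) :
    F q = (q.1 + translation F q.2, transverse F q.2) :=
  Prod.ext (hF.fst_apply hτ hlm q) (hF.snd_apply q)

theorem transverse_transverse {G : Model → Model} (hFG : ∀ q, q ≠ 0 → F (G q) = q) (x : ℝ≥0) :
    transverse F (transverse G x) = x := by
  have := congrArg Prod.snd (hFG _ (base_ne_zero x))
  rwa [hF.snd_apply] at this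

end IsEquivariantLift

end HopfData

end LCReeb

end

/-! ### Surjectivity: every automorphism comes from a translation -/

noncomputable section

namespace LCReeb

theorem extendZero_restrict {b : ℝ≥0 → ℂ} (h0 : b 0 = 0) (x : ℝ≥0) :
    extendZero (fun y : PosLine => b y.1) x = b x := by
  rcases eq_or_ne x 0 with rfl | hx
  · simp [extendZero, h0]
  · simp [extendZero, pos_iff_ne_zero.2 hx]

namespace HopfData

variable {D : HopfData}

/-- Every automorphism of `R` fixing the boundary is induced by a leafwise translation of `R̃`. -/
theorem exists_coverAut (hφ : InfinitelyTangentToId D.φ) (hτ : D.tau = 0) (hlm : D.lam = D.mu)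
    (f : D.AutRelBoundary) :
    ∃ s : SemidirectProduct (Multiplicative (Sol D.φ D.lam × Sol D.φ D.lam))
        (Centr D.φ) (precompAction D.φ D.lam),
      ∀ q r : D.Cover, coverAut hφ s q.1 = r.1 → f.1 (D.proj q) = D.proj r := by
  obtain ⟨F, hF⟩ := exists_isBoundaryLift f.2.2
  -- The lift of f⁻¹ is needed so that the transverse component has a smooth inverse.
  obtain ⟨G, hG⟩ := exists_isBoundaryLift (f⁻¹).2.2
  have hE := hF.isEquivariantLift f.2.1
  have hE' := hG.isEquivariantLift (f⁻¹).2.1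
  have hFG : ∀ q, q ≠ 0 → extendCover F (extendCover G q) = q := fun q hq => by
    rw [extendCover_apply G ⟨q, hq⟩, extendCover_apply,
      hF.comp_apply_of_mul_eq_one hG (mul_inv_cancel f.1)]
  have hGF : ∀ q, q ≠ 0 → extendCover G (extendCover F q) = q := fun q hq => by
    rw [extendCover_apply F ⟨q, hq⟩, extendCover_apply,
      hG.comp_apply_of_mul_eq_one hF (inv_mul_cancel f.1)]
  let η₀ : ℝ≥0 ≃ₜ ℝ≥0 :=
    { toFun := IsEquivariantLift.transverse (extendCover F)
      invFun := IsEquivariantLift.transverse (extendCover G)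
      left_inv := hE'.transverse_transverse hGF
      right_inv := hE.transverse_transverse hFG
      continuous_toFun := hE.continuous_transverse
      continuous_invFun := hE'.continuous_transverse }
  let η₁ : HalfLineDiffeo := ⟨η₀, hE.smoothHalfLine_transverse, hE'.smoothHalfLine_transverse⟩
  let η : Centr D.φ := ⟨η₁, Subgroup.mem_centralizer_singleton_iff.2 <|
    Subtype.ext <| Homeomorph.ext fun x => hE.transverse_map x⟩
  -- The isomorphism evaluates solutions at η(x), so the translation vector is reparametrized by
  -- η⁻¹. It still satisfies the functional equation because η commutes with φ.
  set b : ℝ≥0 → ℂ × ℂ := fun x =>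
    IsEquivariantLift.translation (extendCover F) (η₀.symm x) with hb
  have hb0 : b 0 = 0 := by rw [hb]; simp only [homeo_map_zero, hE.translation_zero]
  have hbs : ContDiffOn ℝ ∞ (fun x : ℝ => b x.toNNReal) (Ici 0) := by
    have h2 : ContDiffOn ℝ ∞ (fun x : ℝ => (η₀.symm x.toNNReal : ℝ)) (Ici 0) :=
      hE'.smoothHalfLine_transverse
    refine (hE.contDiffOn_translation.comp h2 fun x _ => NNReal.coe_nonneg _).congr fun x _ => ?_
    simp [hb]
  have hbφ : ∀ x, b (D.φ.1 x) = D.lam • b x := fun x => by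
    have h1 : η₀.symm (D.φ.1 x) = D.φ.1 (η₀.symm x) := by
      rw [Homeomorph.symm_apply_eq]
      refine ((hE.transverse_map (η₀.symm x)).trans ?_).symm
      exact congrArg D.φ.1 (η₀.apply_symm_apply x)
    change IsEquivariantLift.translation _ (η₀.symm (D.φ.1 x)) = _
    rw [h1, hE.translation_map hτ hlm]
  let β₁ : Sol D.φ D.lam := ⟨fun x => (b x.1).1,
    (hbs.fst.mono Ioi_subset_Ici_self).congr fun x _ =>
      extendZero_restrict (b := fun x => (b x).1) (by rw [hb0]; rfl) _,
    fun x => congrArg Prod.fst (hbφ x.1)⟩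
  let β₂ : Sol D.φ D.lam := ⟨fun x => (b x.1).2,
    (hbs.snd.mono Ioi_subset_Ici_self).congr fun x _ =>
      extendZero_restrict (b := fun x => (b x).2) (by rw [hb0]; rfl) _,
    fun x => congrArg Prod.snd (hbφ x.1)⟩
  refine ⟨⟨Multiplicative.ofAdd (β₁, β₂), η⟩, fun q r hqr => ?_⟩
  have hshear : coverAut hφ ⟨Multiplicative.ofAdd (β₁, β₂), η⟩ q.1 = extendCover F q.1 := by
    have hb' : b (η₀ q.1.2) = IsEquivariantLift.translation (extendCover F) q.1.2 := by
      rw [hb]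
      simp only [Homeomorph.symm_apply_apply]
    have e1 : extendZero β₁.1 (η₀ q.1.2) = (b (η₀ q.1.2)).1 :=
      extendZero_restrict (b := fun x => (b x).1) (by rw [hb0]; rfl) _
    have e2 : extendZero β₂.1 (η₀ q.1.2) = (b (η₀ q.1.2)).2 :=
      extendZero_restrict (b := fun x => (b x).2) (by rw [hb0]; rfl) _
    rw [hE.apply_eq hτ hlm, ← hb']
    refine Prod.ext (Prod.ext ?_ ?_) rfl
    · exact congrArg (q.1.1.1 + ·) e1
    · exact congrArg (q.1.1.2 + ·) e2
  rw [← hF.proj_apply]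
  congr 1
  refine Subtype.ext ?_
  rw [← extendCover_apply, ← hshear, hqr]

end HopfData

end LCReeb

end

/-! ### The isomorphism -/

theorem theorem3p9 (D : LCReeb.HopfData) (hφ : LCReeb.InfinitelyTangentToId D.φ)
    (hτ : D.tau = 0) (hlm : D.lam = D.mu) :
    ¬ FiniteDimensional ℂ (LCReeb.Sol D.φ D.lam) ∧
    ∃ e : SemidirectProduct (Multiplicative (LCReeb.Sol D.φ D.lam × LCReeb.Sol D.φ D.lam))
        (LCReeb.Centr D.φ) (LCReeb.precompAction D.φ D.lam) ≃* D.AutRelBoundary,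
      ∀ (β₁ β₂ : LCReeb.Sol D.φ D.lam) (η : LCReeb.Centr D.φ) (q : D.Cover),
        ∃ r : D.Cover,
          r.1 = ((q.1.1.1 + LCReeb.extendZero β₁.1 (η.1.1 q.1.2),
                  q.1.1.2 + LCReeb.extendZero β₂.1 (η.1.1 q.1.2)), η.1.1 q.1.2) ∧
          (e ⟨Multiplicative.ofAdd (β₁, β₂), η⟩).1 (D.proj q) = D.proj r := by
  refine ⟨LCReeb.not_finiteDimensional_sol D.expanding D.lam_ne_zero, ?_⟩
  -- The choice is harmless: `proj` is surjective, so the relation to `coverAut` determines Φ s.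
  -- Multiplicativity is therefore inherited from the covering maps.
  choose Φ hΦ using fun s => LCReeb.HopfData.exists_autRelBoundary hφ s hτ hlm
  have hne : ∀ s (q : D.Cover), LCReeb.HopfData.coverAut hφ s q.1 ≠ 0 := fun s q h =>
    q.2 ((LCReeb.HopfData.coverAut hφ s).injective
      (h.trans (LCReeb.HopfData.coverAut_boundary hφ s (q := 0) rfl).symm))
  have hmul : ∀ s t, Φ (s * t) = Φ s * Φ t := fun s t => by
    refine Subtype.ext (Homeomorph.ext fun P => ?_)
    obtain ⟨q, rfl⟩ := D.surjective_proj P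
    rw [hΦ (s * t) q ⟨_, hne (s * t) q⟩ rfl]
    change _ = (Φ s).1 ((Φ t).1 (D.proj q))
    rw [hΦ t q ⟨_, hne t q⟩ rfl]
    exact (hΦ s _ _ (LCReeb.HopfData.coverAut_mul hφ s t q.1).symm).symm
  have hinj : Function.Injective (MonoidHom.mk' Φ hmul) := by
    rw [injective_iff_map_eq_one]
    intro s hs
    refine LCReeb.HopfData.coverAut_eq_one_of_proj hφ s fun q r hqr => ?_
    rw [← hΦ s q r hqr]
    exact (congrArg (fun f : D.AutRelBoundary => f.1 (D.proj q)) hs).symm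
  have hsurj : Function.Surjective (MonoidHom.mk' Φ hmul) := fun f => by
    obtain ⟨s, hs⟩ := LCReeb.HopfData.exists_coverAut hφ hτ hlm f
    refine ⟨s, Subtype.ext (Homeomorph.ext fun P => ?_)⟩
    obtain ⟨q, rfl⟩ := D.surjective_proj P
    exact (hΦ s q ⟨_, hne s q⟩ rfl).trans (hs q ⟨_, hne s q⟩ rfl).symm
  exact ⟨MulEquiv.ofBijective _ ⟨hinj, hsurj⟩, fun β₁ β₂ η q =>
    ⟨⟨_, hne ⟨Multiplicative.ofAdd (β₁, β₂), η⟩ q⟩, rfl, hΦ _ q _ rfl⟩⟩
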